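/- Consider the following problem. An instance consists of $n$ distinct inner points $v_1,\dots,v_n$ in the Euclidean plane, $m$ terminal pairs of points $T=\{(t_1,t_1'),\dots,(t_m,t_m')\}$ and $\ell$ hull pairs of points $H=\{(h_1,h_1'),\dots,(h_\ell,h_\ell')\}$, where $h_i$ and $h_i'$ are neighbors on the convex hull of the set of all points of the instance. A solution consists of $m+\ell$ polygonal paths: for each pair $(p,p')$ in $T$ and in $H$ a path from $p$ to $p'$ whose intermediate vertices are inner points, such that every inner point is included in exactly one of the paths, exactly once. A solution is optimal if its total length is smallest. It is assumed that in every optimal solution the paths have no self-intersections and no two paths intersect, except possibly at their ends. The path on a pair $(p,p')$ is redundant if it contains no inner point, i.e. if it is just the edge from $p$ to $p'$. There is an algorithm for the real RAM (with unit-cost arithmetic, comparisons and square roots of reals, and with integers of $O(\log(m+\ell))$ bits) that, given any such instance with $m+\ell>n^2$, finds in $O\bigl((m+\ell)\max(1,n)^2+n^6\bigr)$ time and $O(m+\ell)$ space sets $T_0\subseteq T$ and $H_0\subseteq H$ with $|T_0|+|H_0|=m+\ell-n^2$ such that there is an optimal solution in which the paths on the pairs from $T_0\cup H_0$ are all redundant.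 The constants in the $O$-bounds are absolute. -/

import Mathlib

noncomputable section

/-! ## A real RAM

Programs are structured programs over a real RAM.  The memory consists of integer and real scalar
registers, and of integer and real arrays; a program mentions finitely many registers and arrays.
Real numbers are stored exactly, and the arithmetic operations, square roots and comparisons of
reals take unit time.  There is no conversion from reals to integers.  Integers (used for indices,
counters and addresses) are natural numbers that have to respect a word bound `W`. -/

namespace RealRAM

/-- The contents of the memory. `iarr a i` and `rarr a i` are the cells with address `i` in the
integer array `a` and the real array `a`. -/
structure State where
  ireg : ℕ → ℕ
  rreg : ℕ → ℝ
  iarr : ℕ → ℕ → ℕ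
  rarr : ℕ → ℕ → ℝ

/-- Integer expressions (`sub` is truncated subtraction, `div` the integer quotient). -/
inductive IExp where
  | const (c : ℕ)
  | reg (x : ℕ)
  | get (a : ℕ) (e : IExp)
  | add (e f : IExp)
  | sub (e f : IExp)
  | mul (e f : IExp)
  | div (e f : IExp)
  | mod (e f : IExp)

namespace IExp

/-- The value of an integer expression. -/
def eval (s : State) : IExp → ℕ
  | const c => c
  | reg x => s.ireg x
  | get a e => s.iarr a (e.eval s)
  | add e f => e.eval s + f.eval s
  | sub e f => e.eval s - f.eval s
  | mul e f => e.eval s * f.eval s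
  | div e f => e.eval s / f.eval s
  | mod e f => e.eval s % f.eval s

/-- The time for evaluating an integer expression: one unit for each operation. -/
def cost : IExp → ℕ
  | const _ => 1
  | reg _ => 1
  | get _ e => e.cost + 1
  | add e f => e.cost + f.cost + 1
  | sub e f => e.cost + f.cost + 1
  | mul e f => e.cost + f.cost + 1
  | div e f => e.cost + f.cost + 1
  | mod e f => e.cost + f.cost + 1

/-- The evaluation succeeds: it reads only array cells with address below `S`, produces only
integers that are at most `W`, and never divides by zero. -/
def Ok (S W : ℕ) (s : State) : IExp → Prop
  | const c => c ≤ W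
  | reg _ => True
  | get _ e => e.Ok S W s ∧ e.eval s < S
  | add e f => e.Ok S W s ∧ f.Ok S W s ∧ e.eval s + f.eval s ≤ W
  | sub e f => e.Ok S W s ∧ f.Ok S W s
  | mul e f => e.Ok S W s ∧ f.Ok S W s ∧ e.eval s * f.eval s ≤ W
  | div e f => e.Ok S W s ∧ f.Ok S W s ∧ f.eval s ≠ 0
  | mod e f => e.Ok S W s ∧ f.Ok S W s ∧ f.eval s ≠ 0

end IExp

/-- Real expressions. -/
inductive RExp where
  | ofInt (e : IExp)
  | reg (x : ℕ)
  | get (a : ℕ) (e : IExp)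
  | add (e f : RExp)
  | sub (e f : RExp)
  | mul (e f : RExp)
  | div (e f : RExp)
  | sqrt (e : RExp)

namespace RExp

/-- The value of a real expression. -/
def eval (s : State) : RExp → ℝ
  | ofInt e => (e.eval s : ℝ)
  | reg x => s.rreg x
  | get a e => s.rarr a (e.eval s)
  | add e f => e.eval s + f.eval s
  | sub e f => e.eval s - f.eval s
  | mul e f => e.eval s * f.eval s
  | div e f => e.eval s / f.eval s
  | sqrt e => Real.sqrt (e.eval s)

/-- The time for evaluating a real expression: one unit for each operation. -/
def cost : RExp → ℕ
  | ofInt e => e.cost + 1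
  | reg _ => 1
  | get _ e => e.cost + 1
  | add e f => e.cost + f.cost + 1
  | sub e f => e.cost + f.cost + 1
  | mul e f => e.cost + f.cost + 1
  | div e f => e.cost + f.cost + 1
  | sqrt e => e.cost + 1

/-- The evaluation succeeds within the address bound `S` and the word bound `W`; there is no
division by zero and no square root of a negative number. -/
def Ok (S W : ℕ) (s : State) : RExp → Prop
  | ofInt e => e.Ok S W s
  | reg _ => True
  | get _ e => e.Ok S W s ∧ e.eval s < S
  | add e f => e.Ok S W s ∧ f.Ok S W s
  | sub e f => e.Ok S W s ∧ f.Ok S W s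
  | mul e f => e.Ok S W s ∧ f.Ok S W s
  | div e f => e.Ok S W s ∧ f.Ok S W s ∧ f.eval s ≠ 0
  | sqrt e => e.Ok S W s ∧ 0 ≤ e.eval s

end RExp

/-- Tests: comparisons of integers and of reals, and Boolean combinations of them. -/
inductive Test where
  | ilt (e f : IExp)
  | ieq (e f : IExp)
  | rlt (e f : RExp)
  | not (b : Test)
  | and (b c : Test)

namespace Test

/-- The test is positive. -/
def Holds (s : State) : Test → Prop
  | ilt e f => e.eval s < f.eval s
  | ieq e f => e.eval s = f.eval s
  | rlt e f => e.eval s < f.eval s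
  | not b => ¬ b.Holds s
  | and b c => b.Holds s ∧ c.Holds s

/-- The time for evaluating a test: one unit for each operation. -/
def cost : Test → ℕ
  | ilt e f => e.cost + f.cost + 1
  | ieq e f => e.cost + f.cost + 1
  | rlt e f => e.cost + f.cost + 1
  | not b => b.cost + 1
  | and b c => b.cost + c.cost + 1

/-- The evaluation of the test succeeds within the address bound `S` and the word bound `W`. -/
def Ok (S W : ℕ) (s : State) : Test → Prop
  | ilt e f => e.Ok S W s ∧ f.Ok S W s
  | ieq e f => e.Ok S W s ∧ f.Ok S W s
  | rlt e f => e.Ok S W s ∧ f.Ok S W s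
  | not b => b.Ok S W s
  | and b c => b.Ok S W s ∧ c.Ok S W s

end Test

/-- Programs: assignments to registers (`iset`, `rset`) and to array cells (`iput a e f`, which is
`a[e] := f`, and `rput`), sequences, case distinctions and while loops. -/
inductive Prog where
  | skip
  | iset (x : ℕ) (e : IExp)
  | rset (x : ℕ) (e : RExp)
  | iput (a : ℕ) (e f : IExp)
  | rput (a : ℕ) (e : IExp) (f : RExp)
  | seq (p q : Prog)
  | cond (b : Test) (p q : Prog)
  | loop (b : Test) (p : Prog)

/-- `Exec S W p s t s'`: started in the state `s`, the program `p` halts in the state `s'` after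
exactly `t` steps; it accesses only array cells with address below `S` (so that its memory consists
of at most `S` cells for each of the finitely many arrays that `p` mentions, and of the finitely
many registers that `p` mentions), and all integers computed on the way are at most `W`. -/
inductive Exec (S W : ℕ) : Prog → State → ℕ → State → Prop
  | skip (s : State) : Exec S W Prog.skip s 1 s
  | iset (x : ℕ) (e : IExp) (s : State) (he : e.Ok S W s) :
      Exec S W (Prog.iset x e) s (e.cost + 1)
        { s with ireg := Function.update s.ireg x (e.eval s) }
  | rset (x : ℕ) (e : RExp) (s : State) (he : e.Ok S W s) :
      Exec S W (Prog.rset x e) s (e.cost + 1)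
        { s with rreg := Function.update s.rreg x (e.eval s) }
  | iput (a : ℕ) (e f : IExp) (s : State) (he : e.Ok S W s) (ha : e.eval s < S)
      (hf : f.Ok S W s) :
      Exec S W (Prog.iput a e f) s (e.cost + f.cost + 1)
        { s with iarr := Function.update s.iarr a
                          (Function.update (s.iarr a) (e.eval s) (f.eval s)) }
  | rput (a : ℕ) (e : IExp) (f : RExp) (s : State) (he : e.Ok S W s) (ha : e.eval s < S)
      (hf : f.Ok S W s) :
      Exec S W (Prog.rput a e f) s (e.cost + f.cost + 1)
        { s with rarr := Function.update s.rarr a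
                          (Function.update (s.rarr a) (e.eval s) (f.eval s)) }
  | seq (p q : Prog) (s s₁ s₂ : State) (t₁ t₂ : ℕ) (h₁ : Exec S W p s t₁ s₁)
      (h₂ : Exec S W q s₁ t₂ s₂) :
      Exec S W (Prog.seq p q) s (t₁ + t₂) s₂
  | cond_true (b : Test) (p q : Prog) (s s' : State) (t : ℕ) (hok : b.Ok S W s)
      (hb : b.Holds s) (h : Exec S W p s t s') :
      Exec S W (Prog.cond b p q) s (b.cost + 1 + t) s'
  | cond_false (b : Test) (p q : Prog) (s s' : State) (t : ℕ) (hok : b.Ok S W s)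
      (hb : ¬ b.Holds s) (h : Exec S W q s t s') :
      Exec S W (Prog.cond b p q) s (b.cost + 1 + t) s'
  | loop_true (b : Test) (p : Prog) (s s₁ s₂ : State) (t₁ t₂ : ℕ) (hok : b.Ok S W s)
      (hb : b.Holds s) (h₁ : Exec S W p s t₁ s₁) (h₂ : Exec S W (Prog.loop b p) s₁ t₂ s₂) :
      Exec S W (Prog.loop b p) s (b.cost + 1 + t₁ + t₂) s₂
  | loop_false (b : Test) (p : Prog) (s : State) (hok : b.Ok S W s) (hb : ¬ b.Holds s) :
      Exec S W (Prog.loop b p) s (b.cost + 1) s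

end RealRAM

/-! ## The generalized Euclidean traveling salesman problem with hull pairs -/

namespace GETSPH

/-- The Euclidean plane. -/
abbrev Plane := EuclideanSpace ℝ (Fin 2)

/-- The data of an instance: `n` inner points, `m` terminal pairs and `l` hull pairs. -/
structure Data (n m l : ℕ) where
  V : Fin n → Plane
  T : Fin m → Plane × Plane
  H : Fin l → Plane × Plane

/-- The length of the polygonal path through the given points. -/
def polyLength : List Plane → ℝ
  | a :: b :: L => dist a b + polyLength (b :: L)
  | _ => 0

/-- The set of all points on the polygonal path through the given points. -/
def polyTrace (L : List Plane) : Set Plane :=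
  {z | ∃ (i : ℕ) (h : i + 1 < L.length), z ∈ segment ℝ L[i] L[i + 1]}

/-- The polygonal path through the points of `L` has no self-intersection: a point common to two of
its edges is the vertex between two consecutive edges, or, if the path is closed and the edges are
the first and the last one, its common start and end point. -/
def IsNonSelfIntersecting (L : List Plane) : Prop :=
  ∀ (i j : ℕ) (_ : i < j) (_ : j + 1 < L.length),
    ∀ z ∈ segment ℝ L[i] L[i + 1] ∩ segment ℝ L[j] L[j + 1],
      (j = i + 1 ∧ z = L[j]) ∨
        (i = 0 ∧ j + 2 = L.length ∧ z = L[0] ∧ z = L[L.length - 1])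

namespace Data

variable {n m l : ℕ} (I : Data n m l)

/-- All pairs: first the terminal pairs, and then the hull pairs. -/
def pair : Fin (m + l) → Plane × Plane := Fin.append I.T I.H

/-- The set of all points of the instance. -/
def allPoints : Set Plane :=
  Set.range I.V ∪ {z | ∃ j, z = (I.pair j).1 ∨ z = (I.pair j).2}

/-- `p` and `q` are neighbors on the convex hull of the set of all points: the segment between them
is a part of the boundary of the convex hull, and no other point of the set lies on it. -/
def AreHullNeighbors (p q : Plane) : Prop :=
  p ≠ q ∧ segment ℝ p q ⊆ frontier (convexHull ℝ I.allPoints) ∧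
    ∀ z ∈ I.allPoints, z ∉ openSegment ℝ p q

/-- A candidate for a solution gives for each pair the list of the inner points on the path built on
this pair. It is a solution if every inner point is included in exactly one of the paths; a path
does not visit a point twice. -/
def IsSolution (σ : Fin (m + l) → List (Fin n)) : Prop :=
  (∀ j, (σ j).Nodup) ∧ ∀ v : Fin n, ∃! j, v ∈ σ j

/-- The path on the pair with index `j`, as the list of its vertices. -/
def path (σ : Fin (m + l) → List (Fin n)) (j : Fin (m + l)) : List Plane :=
  (I.pair j).1 :: ((σ j).map I.V ++ [(I.pair j).2])

/-- The total length of the paths. -/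
def totalLength (σ : Fin (m + l) → List (Fin n)) : ℝ :=
  ∑ j, polyLength (I.path σ j)

/-- An optimal solution: a solution with the smallest total length. -/
def IsOptimal (σ : Fin (m + l) → List (Fin n)) : Prop :=
  IsSolution σ ∧ ∀ τ : Fin (m + l) → List (Fin n), IsSolution τ →
    I.totalLength σ ≤ I.totalLength τ

/-- The paths have no self-intersections, and two different paths meet at most at their ends. -/
def IsNonCrossing (σ : Fin (m + l) → List (Fin n)) : Prop :=
  (∀ j, IsNonSelfIntersecting (I.path σ j)) ∧
  ∀ j k, j ≠ k → ∀ z ∈ polyTrace (I.path σ j) ∩ polyTrace (I.path σ k),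
    (z = (I.pair j).1 ∨ z = (I.pair j).2) ∧ (z = (I.pair k).1 ∨ z = (I.pair k).2)

/-- The data form an instance of the problem: the inner points are distinct, the points of every
hull pair are neighbors on the convex hull of the set of all points, and the paths of any optimal
solution have no self-intersections and do not intersect each other, except possibly at the ends. -/
structure IsInstance : Prop where
  injective_V : Function.Injective I.V
  hull : ∀ i, I.AreHullNeighbors (I.H i).1 (I.H i).2
  nonCrossing : ∀ σ, I.IsOptimal σ → I.IsNonCrossing σ

/-- A finite sequence of reals as the contents of a real array, followed by zeros. -/
def arrayOf {k : ℕ} (f : Fin k → ℝ) (i : ℕ) : ℝ :=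
  if h : i < k then f ⟨i, h⟩ else 0

/-- The initial state of the memory: the integer registers `0`, `1`, `2` hold `n`, `m`, `l`; the
real arrays `0`, `1` hold the coordinates of the inner points; the real arrays `2`, `3` and `4`, `5`
hold the coordinates of the first and second points of all pairs (first the terminal pairs, then the
hull pairs). All the rest is `0`. -/
def input : RealRAM.State where
  ireg x := match x with
    | 0 => n
    | 1 => m
    | 2 => l
    | _ => 0
  rreg _ := 0
  iarr _ _ := 0
  rarr a := match a with
    | 0 => arrayOf fun i => I.V i 0
    | 1 => arrayOf fun i => I.V i 1
    | 2 => arrayOf fun j => (I.pair j).1 0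
    | 3 => arrayOf fun j => (I.pair j).1 1
    | 4 => arrayOf fun j => (I.pair j).2 0
    | 5 => arrayOf fun j => (I.pair j).2 1
    | _ => fun _ => 0

end Data

/-- The output that is represented by a final state of the memory: the integer array `0` marks the
chosen terminal pairs and hull pairs (in the order of the input) by the entry `1`. -/
def IsOutput {m l : ℕ} (s : RealRAM.State) (T₀ : Finset (Fin m)) (H₀ : Finset (Fin l)) : Prop :=
  (∀ i : Fin m, i ∈ T₀ ↔ s.iarr 0 i = 1) ∧ ∀ i : Fin l, i ∈ H₀ ↔ s.iarr 0 (m + i) = 1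

end GETSPH

end

/-!
Write `N = m + l`. The path on a pair that is not redundant has a first inner point `p` and a last
inner point `q`, and its length exceeds the length of the edge by the detour through `p` and `q`,
which depends on the pair, plus a term that depends only on the inner part of the path. Hence, once
the inner parts are fixed, an optimal solution is a cheapest assignment of some of the `n²` types
`(p, q)` to different pairs. Let `M` be a cheapest assignment of *all* types to pairs. By an exchange
along alternating paths, justified by the dual prices of `M`, any assignment of some of the types can
be moved to pairs that are used by `M` at no extra cost (`exists_exchange`); so some optimal solution
has redundant paths on all pairs outside the range of `M` (`Data.exists_isOptimal_of_dual`), and these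
are `N - n²` pairs.

The assignment `M` is computed by the Hungarian method with the types as rows and the pairs as
columns: `n²` phases, in each of which an alternating tree grows by at most `n²` rows. The detours are
nonnegative, so zero potentials are feasible at the start. Only the potentials of the rows are stored:
the potential of a matched column is determined by tightness, and that of a free column is zero. The
lemmas `Scanned.scan`, `Scanned.shift`, `Tree.insert` and `Augmenting.step` are the mathematical steps
of the method.

When a row is scanned, its best free column is needed. To find it within the bounds for time and
space, the columns are divided into blocks of `n²` columns, and a table holds the best free column for
each row in each block. The table has `O(N)` entries and takes `O(n² N)` time to set up. The scan of a
row looks at `O(N / n²)` entries, and takes `O(n²)` time for the matched columns, so all `n⁴` scans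
together take `O(n² N + n⁶)` time. When a column gets matched, one
block has to be recomputed for each of the `n²` rows, in `O(n⁴)` time per phase.

Correctness and time bounds of the programs are derived in a small calculus of timed total
correctness, with the judgement `Runs`.
-/

noncomputable section

/-! ### Timed total correctness for programs of the real RAM -/

namespace RealRAM

variable {S W : ℕ}

/-- `Runs S W p s T Q`: started in the state `s`, the program `p` halts within `T` steps in a state
that satisfies `Q`. -/
def Runs (S W : ℕ) (p : Prog) (s : State) (T : ℕ) (Q : State → Prop) : Prop :=
  ∃ t s', Exec S W p s t s' ∧ t ≤ T ∧ Q s'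

theorem Runs.mono {p : Prog} {s : State} {T T' : ℕ} {Q Q' : State → Prop}
    (h : Runs S W p s T Q) (hT : T ≤ T') (hQ : ∀ s', Q s' → Q' s') : Runs S W p s T' Q' := by
  obtain ⟨t, s', he, ht, hq⟩ := h
  exact ⟨t, s', he, ht.trans hT, hQ _ hq⟩

theorem Runs.seq {p q : Prog} {s : State} {T₁ T₂ : ℕ} {Q : State → Prop}
    (h : Runs S W p s T₁ fun s' => Runs S W q s' T₂ Q) : Runs S W (.seq p q) s (T₁ + T₂) Q := by
  obtain ⟨t, s', he, ht, t', s'', he', ht', hq⟩ := h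
  exact ⟨_, _, .seq _ _ _ _ _ _ _ he he', by omega, hq⟩

namespace Prog

/-- The integer registers to which a program may write. -/
def iregs : Prog → List ℕ
  | iset x _ => [x]
  | seq p q => p.iregs ++ q.iregs
  | cond _ p q => p.iregs ++ q.iregs
  | loop _ p => p.iregs
  | _ => []

/-- The real registers to which a program may write. -/
def rregs : Prog → List ℕ
  | rset x _ => [x]
  | seq p q => p.rregs ++ q.rregs
  | cond _ p q => p.rregs ++ q.rregs
  | loop _ p => p.rregs
  | _ => []

/-- The integer arrays to which a program may write. -/
def iarrs : Prog → List ℕ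
  | iput a _ _ => [a]
  | seq p q => p.iarrs ++ q.iarrs
  | cond _ p q => p.iarrs ++ q.iarrs
  | loop _ p => p.iarrs
  | _ => []

/-- The real arrays to which a program may write. -/
def rarrs : Prog → List ℕ
  | rput a _ _ => [a]
  | seq p q => p.rarrs ++ q.rarrs
  | cond _ p q => p.rarrs ++ q.rarrs
  | loop _ p => p.rarrs
  | _ => []

/-- The two states agree outside the registers and arrays to which the program may write. -/
structure Frame (p : Prog) (s s' : State) : Prop where
  ireg : ∀ x, x ∉ p.iregs → s'.ireg x = s.ireg x
  rreg : ∀ x, x ∉ p.rregs → s'.rreg x = s.rreg x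
  iarr : ∀ a, a ∉ p.iarrs → s'.iarr a = s.iarr a
  rarr : ∀ a, a ∉ p.rarrs → s'.rarr a = s.rarr a

theorem Frame.refl (p : Prog) (s : State) : p.Frame s s :=
  ⟨fun _ _ => rfl, fun _ _ => rfl, fun _ _ => rfl, fun _ _ => rfl⟩

theorem Frame.trans {p : Prog} {s s' s'' : State} (h : p.Frame s s') (h' : p.Frame s' s'') :
    p.Frame s s'' :=
  ⟨fun x hx => (h'.ireg x hx).trans (h.ireg x hx), fun x hx => (h'.rreg x hx).trans (h.rreg x hx),
    fun x hx => (h'.iarr x hx).trans (h.iarr x hx), fun x hx => (h'.rarr x hx).trans (h.rarr x hx)⟩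

theorem Frame.of_subset {p q : Prog} {s s' : State} (h : p.Frame s s')
    (h₁ : p.iregs ⊆ q.iregs) (h₂ : p.rregs ⊆ q.rregs) (h₃ : p.iarrs ⊆ q.iarrs)
    (h₄ : p.rarrs ⊆ q.rarrs) : q.Frame s s' :=
  ⟨fun x hx => h.ireg x fun h => hx (h₁ h), fun x hx => h.rreg x fun h => hx (h₂ h),
    fun x hx => h.iarr x fun h => hx (h₃ h), fun x hx => h.rarr x fun h => hx (h₄ h)⟩

end Prog

theorem Exec.frame {p : Prog} {s s' : State} {t : ℕ} (h : Exec S W p s t s') : p.Frame s s' := by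
  induction h with
  | skip => exact .refl _ _
  | iset x e s => exact ⟨fun y hy => Function.update_of_ne (by simpa [Prog.iregs] using hy) _ _,
      fun _ _ => rfl, fun _ _ => rfl, fun _ _ => rfl⟩
  | rset x e s => exact ⟨fun _ _ => rfl, fun y hy =>
      Function.update_of_ne (by simpa [Prog.rregs] using hy) _ _, fun _ _ => rfl, fun _ _ => rfl⟩
  | iput a e f s => exact ⟨fun _ _ => rfl, fun _ _ => rfl, fun y hy =>
      Function.update_of_ne (by simpa [Prog.iarrs] using hy) _ _, fun _ _ => rfl⟩
  | rput a e f s => exact ⟨fun _ _ => rfl, fun _ _ => rfl, fun _ _ => rfl, fun y hy =>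
      Function.update_of_ne (by simpa [Prog.rarrs] using hy) _ _⟩
  | seq p q _ _ _ _ _ _ _ h₁ h₂ =>
    exact (h₁.of_subset (by simp [Prog.iregs]) (by simp [Prog.rregs]) (by simp [Prog.iarrs])
      (by simp [Prog.rarrs])).trans (h₂.of_subset (by simp [Prog.iregs]) (by simp [Prog.rregs])
      (by simp [Prog.iarrs]) (by simp [Prog.rarrs]))
  | cond_true _ _ _ _ _ _ _ _ _ h =>
    exact h.of_subset (by simp [Prog.iregs]) (by simp [Prog.rregs])
      (by simp [Prog.iarrs]) (by simp [Prog.rarrs])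
  | cond_false _ _ _ _ _ _ _ _ _ h =>
    exact h.of_subset (by simp [Prog.iregs]) (by simp [Prog.rregs])
      (by simp [Prog.iarrs]) (by simp [Prog.rarrs])
  | loop_true _ _ _ _ _ _ _ _ _ _ _ h₁ h₂ =>
    exact (h₁.of_subset (by simp [Prog.iregs]) (by simp [Prog.rregs]) (by simp [Prog.iarrs])
      (by simp [Prog.rarrs])).trans h₂
  | loop_false => exact .refl _ _

/-- What a program does not write to stays unchanged. -/
theorem Runs.frame {p : Prog} {s : State} {T : ℕ} {Q : State → Prop} (h : Runs S W p s T Q) :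
    Runs S W p s T fun s' => Q s' ∧ p.Frame s s' := by
  obtain ⟨t, s', he, ht, hq⟩ := h
  exact ⟨t, s', he, ht, hq, he.frame⟩

theorem Runs.seq_frame {p q : Prog} {s : State} {T₁ T₂ : ℕ} {R Q : State → Prop}
    (h : Runs S W p s T₁ R) (h' : ∀ s', p.Frame s s' → R s' → Runs S W q s' T₂ Q) :
    Runs S W (.seq p q) s (T₁ + T₂) Q :=
  Runs.seq (h.frame.mono le_rfl fun s' hs' => h' s' hs'.2 hs'.1)

namespace Prog

/-- An upper bound for the running time of a loop-free program; the value at loops is irrelevant. -/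
def cost : Prog → ℕ
  | skip => 1
  | iset _ e => e.cost + 1
  | rset _ e => e.cost + 1
  | iput _ e f => e.cost + f.cost + 1
  | rput _ e f => e.cost + f.cost + 1
  | seq p q => p.cost + q.cost
  | cond b p q => b.cost + 1 + (p.cost + q.cost)
  | loop _ _ => 0

/-- The weakest precondition of a loop-free program for total correctness. Loops have their own
rules, and their precondition here is `False`. -/
def wp (S W : ℕ) (Q : State → Prop) : Prog → State → Prop
  | skip, s => Q s
  | iset x e, s => e.Ok S W s ∧ Q { s with ireg := Function.update s.ireg x (e.eval s) }
  | rset x e, s => e.Ok S W s ∧ Q { s with rreg := Function.update s.rreg x (e.eval s) }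
  | iput a e f, s => (e.Ok S W s ∧ e.eval s < S ∧ f.Ok S W s) ∧
      Q { s with iarr := Function.update s.iarr a
                          (Function.update (s.iarr a) (e.eval s) (f.eval s)) }
  | rput a e f, s => (e.Ok S W s ∧ e.eval s < S ∧ f.Ok S W s) ∧
      Q { s with rarr := Function.update s.rarr a
                          (Function.update (s.rarr a) (e.eval s) (f.eval s)) }
  | seq p q, s => wp S W (wp S W Q q) p s
  | cond b p q, s => b.Ok S W s ∧ (b.Holds s → wp S W Q p s) ∧ (¬ b.Holds s → wp S W Q q s)
  | loop _ _, _ => False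

end Prog

theorem Runs.of_wp_cost {p : Prog} {s : State} {Q : State → Prop} (h : p.wp S W Q s) :
    Runs S W p s p.cost Q := by
  induction p generalizing s Q with
  | skip => exact ⟨_, _, .skip s, le_rfl, h⟩
  | iset x e => exact ⟨_, _, .iset x e s h.1, le_rfl, h.2⟩
  | rset x e => exact ⟨_, _, .rset x e s h.1, le_rfl, h.2⟩
  | iput a e f => exact ⟨_, _, .iput a e f s h.1.1 h.1.2.1 h.1.2.2, le_rfl, h.2⟩
  | rput a e f => exact ⟨_, _, .rput a e f s h.1.1 h.1.2.1 h.1.2.2, le_rfl, h.2⟩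
  | seq p q hp hq => exact Runs.seq ((hp h).mono le_rfl fun s' h' => hq h')
  | cond b p q hp hq =>
    by_cases hb : b.Holds s
    · obtain ⟨t, s', he, ht, hq⟩ := hp (h.2.1 hb)
      exact ⟨_, _, .cond_true b p q s s' t h.1 hb he, by simp only [Prog.cost]; omega, hq⟩
    · obtain ⟨t, s', he, ht, hq⟩ := hq (h.2.2 hb)
      exact ⟨_, _, .cond_false b p q s s' t h.1 hb he, by simp only [Prog.cost]; omega, hq⟩
  | loop b p => exact h.elim

theorem Runs.of_wp {p : Prog} {s : State} {T : ℕ} {Q : State → Prop} (hT : p.cost ≤ T)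
    (h : p.wp S W Q s) : Runs S W p s T Q :=
  (Runs.of_wp_cost h).mono hT fun _ h => h

/-- Loop rule. The ghost index `k` of the invariant counts the iterations and stays below `B`. -/
theorem Runs.loop {b : Test} {p : Prog} {s : State} {T : ℕ} (B : ℕ) (Inv : ℕ → State → Prop)
    (h₀ : Inv 0 s) (hok : ∀ k s', p.Frame s s' → Inv k s' → b.Ok S W s')
    (hstep : ∀ k s', p.Frame s s' → Inv k s' → b.Holds s' →
      k < B ∧ Runs S W p s' T (Inv (k + 1))) :
    Runs S W (.loop b p) s (B * (T + b.cost + 1) + b.cost + 1) fun s' =>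
      (∃ k, Inv k s') ∧ ¬ b.Holds s' := by
  have key : ∀ d k s', k + d = B → p.Frame s s' → Inv k s' →
      Runs S W (.loop b p) s' (d * (T + b.cost + 1) + b.cost + 1) fun s' =>
        (∃ k, Inv k s') ∧ ¬ b.Holds s' := by
    intro d
    induction d with
    | zero =>
      intro k s' hk hF hI
      have hb : ¬ b.Holds s' := fun hb => by have := (hstep k s' hF hI hb).1; omega
      exact ⟨_, _, .loop_false b p s' (hok k s' hF hI) hb, by omega, ⟨k, hI⟩, hb⟩
    | succ d ih =>
      intro k s' hk hF hI
      by_cases hb : b.Holds s'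
      · obtain ⟨t, s₁, he, ht, hI₁⟩ := (hstep k s' hF hI hb).2
        obtain ⟨t₂, s₂, he₂, ht₂, hQ⟩ := ih (k + 1) s₁ (by omega) (hF.trans he.frame) hI₁
        exact ⟨_, _, .loop_true b p s' s₁ s₂ t t₂ (hok k s' hF hI) hb he he₂,
          by rw [Nat.succ_mul]; omega, hQ⟩
      · exact ⟨_, _, .loop_false b p s' (hok k s' hF hI) hb, by omega, ⟨k, hI⟩, hb⟩
  exact key B 0 s (by omega) (.refl _ _) h₀

/-- The program `for x := 0 to y - 1 do p`, where `x` and `y` are integer registers. -/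
def Prog.forLoop (x y : ℕ) (p : Prog) : Prog :=
  .seq (.iset x (.const 0))
    (.loop (.ilt (.reg x) (.reg y)) (.seq p (.iset x (.add (.reg x) (.const 1)))))

/-- The state in which the integer register `x` is overwritten by `k`. -/
abbrev State.setI (s : State) (x k : ℕ) : State :=
  { s with ireg := Function.update s.ireg x k }

/-- Rule for loops with a counter. The body has to preserve the invariant up to the increment of the
counter; the frame of the whole loop is available in each iteration. -/
theorem Runs.forLoop {x y : ℕ} {p : Prog} {s : State} {B T : ℕ} (Inv : ℕ → State → Prop)
    (hB : s.ireg y = B) (hBW : B ≤ W) (hxy : y ≠ x) (hx : x ∉ p.iregs) (hy : y ∉ p.iregs)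
    (h₀ : Inv 0 (s.setI x 0))
    (hstep : ∀ k s', k < B → (Prog.forLoop x y p).Frame s s' → s'.ireg x = k → Inv k s' →
      Runs S W p s' T fun s'' => Inv (k + 1) (s''.setI x (k + 1))) :
    Runs S W (Prog.forLoop x y p) s (B * (T + 8) + 6) (Inv B) := by
  have hsub : ∀ {s s'}, Prog.Frame (.seq p (.iset x (.add (.reg x) (.const 1)))) s s' →
      (Prog.forLoop x y p).Frame s s' := fun h =>
    h.of_subset (by simp [Prog.forLoop, Prog.iregs]) (by simp [Prog.forLoop, Prog.rregs])
      (by simp [Prog.forLoop, Prog.iarrs]) (by simp [Prog.forLoop, Prog.rarrs])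
  have hF₀ : (Prog.forLoop x y p).Frame s (s.setI x 0) :=
    ⟨fun z hz => Function.update_of_ne (by rintro rfl; simp [Prog.forLoop, Prog.iregs] at hz) _ _,
      fun _ _ => rfl, fun _ _ => rfl, fun _ _ => rfl⟩
  refine (Runs.seq (T₁ := 2) (T₂ := B * (T + 4 + 3 + 1) + 3 + 1) ?_).mono
    (by ring_nf; omega) fun _ h => h
  refine (Runs.of_wp_cost (p := .iset x (.const 0)) ⟨Nat.zero_le _, ?_⟩)
  refine (Runs.loop (T := T + 4) B
    (fun k s' => s'.ireg y = B ∧ s'.ireg x = k ∧ k ≤ B ∧ Inv k s') ?_ ?_ ?_).mono le_rfl ?_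
  · exact ⟨by simp [hxy, hB], by simp [IExp.eval], Nat.zero_le _, h₀⟩
  · exact fun k s' _ _ => ⟨trivial, trivial⟩
  · rintro k s' hF ⟨hyB, hk, hkB, hI⟩ hb
    have hlt : k < B := by
      have : s'.ireg x < s'.ireg y := hb
      rwa [hk, hyB] at this
    refine ⟨hlt, Runs.seq ?_⟩
    refine ((hstep k s' hlt (hF₀.trans (hsub hF)) hk hI).frame).mono le_rfl ?_
    rintro s'' ⟨h, hF'⟩
    have hx' : s''.ireg x = k := by rw [hF'.ireg x hx, hk]
    refine Runs.of_wp_cost (p := .iset x (.add (.reg x) (.const 1))) ⟨⟨trivial, ?_, ?_⟩, ?_⟩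
    · change 1 ≤ W; omega
    · change s''.ireg x + 1 ≤ W; omega
    · simp only [IExp.eval, hx']
      exact ⟨by simp [hxy, hF'.ireg y hy, hyB], by simp, hlt, h⟩
  · rintro s' ⟨⟨k, hyB, hk, hkB, hI⟩, hb⟩
    have : ¬ s'.ireg x < s'.ireg y := hb
    obtain rfl : k = B := by omega
    exact hI

end RealRAM

/-! ### Exchanging pairs along an optimal assignment -/

namespace GETSPH

open Finset in
/-- Let `M` be an injective assignment of types to pairs that is certified by dual prices `u`, `v`,
with `v` nonpositive and zero outside the range of `M`. Then any assignment of pairs to some of the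
types (given by the types `ty j` of the pairs `j ∈ X`) can be changed into one that uses only pairs
in the range of `M`, at no extra cost: following `j ↦ M (ty j)` from the pairs outside the range, all
pairs that are reached hand over their type to the next one. -/
theorem exists_exchange {A J : Type*} [DecidableEq J] (c : A → J → ℝ) (M : A → J)
    (hM : Function.Injective M) (u : A → ℝ) (v : J → ℝ) (hfeas : ∀ a j, u a + v j ≤ c a j)
    (htight : ∀ a, u a + v (M a) = c a (M a)) (hv : ∀ j, v j ≤ 0)
    (hfree : ∀ j, j ∉ Set.range M → v j = 0) (X : Finset J) (ty : J → A)
    (hty : Set.InjOn ty X) :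
    ∃ ψ : J → J, Set.InjOn ψ X ∧ (∀ j ∈ X, ψ j ∈ Set.range M) ∧
      ∑ j ∈ X, c (ty j) (ψ j) ≤ ∑ j ∈ X, c (ty j) j := by
  classical
  -- the pairs reached from the pairs in `X` outside the range of `M`
  let R : Set J := ⋂₀ {R | (∀ j ∈ X, j ∉ Set.range M → j ∈ R) ∧
    ∀ j ∈ X, j ∈ R → M (ty j) ∈ X → M (ty j) ∈ R}
  have hroot : ∀ j ∈ X, j ∉ Set.range M → j ∈ R := fun j hj hjM R' hR' => hR'.1 j hj hjM
  have hnext : ∀ j ∈ X, j ∈ R → M (ty j) ∈ X → M (ty j) ∈ R := fun j hj hjR hMX R' hR' =>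
    hR'.2 j hj (hjR R' hR') hMX
  -- a reached pair inside the range of `M` has a predecessor, by minimality of `R`
  have hpred : ∀ k ∈ R, k ∈ Set.range M → ∃ j ∈ X, j ∈ R ∧ M (ty j) = k := by
    intro k hk hkM
    by_contra hno
    push Not at hno
    have : k ∈ R \ {k} := hk (R \ {k}) ⟨fun j hj hjM => ⟨hroot j hj hjM, by rintro rfl; exact hjM hkM⟩,
      fun j hj hjR hMX => ⟨hnext j hj hjR.1 hMX, fun h => hno j hj hjR.1 h⟩⟩
    exact this.2 rfl
  have hinj : Set.InjOn (fun j => M (ty j)) X := fun j hj k hk h => hty hj hk (hM h)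
  let ψ : J → J := fun j => if j ∈ R then M (ty j) else j
  refine ⟨ψ, ?_, ?_, ?_⟩
  · intro j hj k hk h
    by_cases h₁ : j ∈ R <;> by_cases h₂ : k ∈ R <;> simp only [ψ, h₁, h₂, if_true, if_false] at h
    · exact hinj hj hk h
    · exact absurd (h ▸ hnext j hj h₁ (h ▸ hk)) h₂
    · exact absurd (h ▸ hnext k hk h₂ (h ▸ hj)) h₁
    · exact h
  · intro j hj
    by_cases h₁ : j ∈ R
    · simp [ψ, h₁]
    · simp only [ψ, h₁, if_false]
      by_contra h
      exact h₁ (hroot j hj h)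
  · -- `Y := X ∩ R` is mapped onto a set that contains `Y ∩ range M`, and `v` vanishes on the rest of `Y`
    have hY : ∑ j ∈ X with j ∈ R, v (M (ty j)) ≤ ∑ j ∈ X with j ∈ R, v j := by
      rw [← Finset.sum_image (f := v) (s := {j ∈ X | j ∈ R}) (g := fun j => M (ty j))
        (hinj.mono fun j hj => (Finset.mem_filter.1 hj).1)]
      have h₁ : ∑ j ∈ X with j ∈ R, v j = ∑ j ∈ X with j ∈ R ∧ j ∈ Set.range M, v j := by
        rw [← Finset.filter_filter]
        exact (Finset.sum_filter_of_ne fun j _ hj => by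
          by_contra h
          exact hj (hfree j h)).symm
      rw [h₁, ← neg_le_neg_iff, ← Finset.sum_neg_distrib, ← Finset.sum_neg_distrib]
      refine Finset.sum_le_sum_of_subset_of_nonneg ?_ fun j _ _ => by linarith [hv j]
      intro k hk
      obtain ⟨-, hk₁, hk₂⟩ := Finset.mem_filter.1 hk
      obtain ⟨j, hj, hjR, rfl⟩ := hpred k hk₁ hk₂
      exact Finset.mem_image.2 ⟨j, Finset.mem_filter.2 ⟨hj, hjR⟩, rfl⟩
    rw [← Finset.sum_filter_add_sum_filter_not X (· ∈ R),
      ← Finset.sum_filter_add_sum_filter_not X (· ∈ R) (fun j => c (ty j) j)]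
    have h₂ : ∑ j ∈ X with j ∉ R, c (ty j) (ψ j) = ∑ j ∈ X with j ∉ R, c (ty j) j :=
      Finset.sum_congr rfl fun j hj => by simp [ψ, (Finset.mem_filter.1 hj).2]
    have h₃ : ∑ j ∈ X with j ∈ R, c (ty j) (ψ j)
        = ∑ j ∈ X with j ∈ R, (u (ty j) + v (M (ty j))) :=
      Finset.sum_congr rfl fun j hj => by simp [ψ, (Finset.mem_filter.1 hj).2, htight]
    have h₄ : ∑ j ∈ X with j ∈ R, (u (ty j) + v j) ≤ ∑ j ∈ X with j ∈ R, c (ty j) j :=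
      Finset.sum_le_sum fun j _ => hfeas _ _
    rw [Finset.sum_add_distrib] at h₃ h₄
    linarith

namespace Data

variable {n m l : ℕ} (I : Data n m l)

/-- The increase in length when the path on the pair `j` makes a detour through the inner points
`a.1` and `a.2`, in this order, instead of being just an edge. -/
def detour (a : Fin n × Fin n) (j : Fin (m + l)) : ℝ :=
  dist (I.pair j).1 (I.V a.1) + dist (I.V a.1) (I.V a.2) + dist (I.V a.2) (I.pair j).2
    - dist (I.pair j).1 (I.pair j).2

theorem polyLength_concat (L : List Plane) (hL : L ≠ []) (q : Plane) :
    polyLength (L ++ [q]) = polyLength L + dist (L.getLast hL) q := by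
  induction L with
  | nil => exact absurd rfl hL
  | cons a L ih =>
    cases L with
    | nil => simp [polyLength]
    | cons b L =>
      have := ih (by simp)
      simp only [List.cons_append, polyLength] at this ⊢
      rw [this, List.getLast_cons (List.cons_ne_nil b L)]
      ring

/-- The length of the path on the pair `j` through the inner points in `L`, minus the length of the
edge. -/
def excess (j : Fin (m + l)) (L : List (Fin n)) : ℝ :=
  polyLength ((I.pair j).1 :: (L.map I.V ++ [(I.pair j).2])) - dist (I.pair j).1 (I.pair j).2

@[simp] theorem excess_nil (j : Fin (m + l)) : I.excess j [] = 0 := by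
  simp [excess, polyLength]

/-- The excess depends on the pair only through the detour to the first and last inner points. -/
theorem excess_eq (j : Fin (m + l)) (L : List (Fin n)) (hL : L ≠ []) :
    I.excess j L = I.detour (L.head hL, L.getLast hL) j + (polyLength (L.map I.V)
      - dist (I.V (L.head hL)) (I.V (L.getLast hL))) := by
  have h : (L.map I.V) ≠ [] := by simpa using hL
  rw [excess, ← List.cons_append, polyLength_concat _ (by simp), List.getLast_cons h,
    List.getLast_map]
  cases L with
  | nil => exact absurd rfl hL
  | cons a L => simp only [List.map_cons, polyLength, List.head_cons, detour]; ring

theorem totalLength_eq (σ : Fin (m + l) → List (Fin n)) :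
    I.totalLength σ = ∑ j, dist (I.pair j).1 (I.pair j).2 + ∑ j, I.excess j (σ j) := by
  rw [← Finset.sum_add_distrib]
  exact Finset.sum_congr rfl fun j _ => by simp [excess, path]

theorem exists_isOptimal (h : 0 < m + l) : ∃ σ, I.IsOptimal σ := by
  have hfin : {σ : Fin (m + l) → List (Fin n) | IsSolution σ}.Finite := by
    refine (Set.finite_range fun (f : Fin (m + l) → {L : List (Fin n) // L.Nodup}) j =>
      (f j : List (Fin n))).subset fun σ hσ => ⟨fun j => ⟨σ j, hσ.1 j⟩, rfl⟩
  have hne : {σ : Fin (m + l) → List (Fin n) | IsSolution σ}.Nonempty := by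
    refine ⟨fun j => if j = ⟨0, h⟩ then List.finRange n else [], fun j => ?_, fun v => ?_⟩
    · dsimp only
      split_ifs
      exacts [List.nodup_finRange n, List.nodup_nil]
    · refine ⟨⟨0, h⟩, by simp, fun j hj => ?_⟩
      by_contra hne
      simp [hne] at hj
  obtain ⟨σ, hσ, hmin⟩ := Set.exists_min_image _ I.totalLength hfin hne
  exact ⟨σ, hσ, hmin⟩

/-- Some optimal solution has redundant paths on all pairs outside the range of a certified
optimal assignment `M` of pairs to the ordered pairs of inner points. -/
theorem exists_isOptimal_of_dual (h : 0 < m + l) (M : Fin n × Fin n → Fin (m + l))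
    (hM : Function.Injective M) (u : Fin n × Fin n → ℝ) (v : Fin (m + l) → ℝ)
    (hfeas : ∀ a j, u a + v j ≤ I.detour a j)
    (htight : ∀ a, u a + v (M a) = I.detour a (M a)) (hv : ∀ j, v j ≤ 0)
    (hfree : ∀ j, j ∉ Set.range M → v j = 0) :
    ∃ σ, I.IsOptimal σ ∧ ∀ j, j ∉ Set.range M → σ j = [] := by
  classical
  obtain ⟨σ, hσ, hopt⟩ := I.exists_isOptimal h
  let X : Finset (Fin (m + l)) := {j | σ j ≠ []}
  have hX : ∀ j, j ∈ X ↔ σ j ≠ [] := by simp [X]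
  have huniq : ∀ {x j k}, x ∈ σ j → x ∈ σ k → j = k := fun {x j k} hj hk =>
    (hσ.2 x).unique hj hk
  rcases X.eq_empty_or_nonempty with hXe | ⟨j₀, hj₀⟩
  · exact ⟨σ, ⟨hσ, hopt⟩, fun j _ => by
      by_contra hj
      simpa [hXe] using (hX j).2 hj⟩
  have hj₀' := (hX j₀).1 hj₀
  let ty : Fin (m + l) → Fin n × Fin n := fun j =>
    if hj : σ j ≠ [] then ((σ j).head hj, (σ j).getLast hj) else ((σ j₀).head hj₀', (σ j₀).head hj₀')
  have hty : ∀ j (hj : σ j ≠ []), ty j = ((σ j).head hj, (σ j).getLast hj) := fun j hj => by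
    simp [ty, hj]
  obtain ⟨ψ, hψ, hψM, hle⟩ := exists_exchange I.detour M hM u v hfeas htight hv hfree X ty (by
    intro j hj k hk hjk
    rw [hty j ((hX j).1 hj), hty k ((hX k).1 hk)] at hjk
    refine huniq (List.head_mem ((hX j).1 hj)) ?_
    rw [(Prod.mk.inj hjk).1]
    exact List.head_mem _)
  -- the inner parts of the paths are moved along `ψ`
  let τ : Fin (m + l) → List (Fin n) := fun k => if hk : ∃ j ∈ X, ψ j = k then σ hk.choose else []
  have hτψ : ∀ j ∈ X, τ (ψ j) = σ j := fun j hj => by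
    have hex : ∃ j' ∈ X, ψ j' = ψ j := ⟨j, hj, rfl⟩
    simp only [τ, dif_pos hex]
    rw [hψ hex.choose_spec.1 hj hex.choose_spec.2]
  have hτ : ∀ k, τ k ≠ [] → ∃ j ∈ X, ψ j = k := fun k hk => by
    by_contra hno
    exact hk (dif_neg hno)
  have hτsol : IsSolution τ := by
    refine ⟨fun k => ?_, fun x => ?_⟩
    · by_cases hk : τ k = []
      · simp [hk]
      · obtain ⟨j, hj, rfl⟩ := hτ k hk
        rw [hτψ j hj]
        exact hσ.1 j
    · obtain ⟨j, hj, -⟩ := hσ.2 x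
      have hjX : j ∈ X := (hX j).2 (List.ne_nil_of_mem hj)
      refine ⟨ψ j, by simpa [hτψ j hjX] using hj, fun k hk => ?_⟩
      obtain ⟨j', hj', rfl⟩ := hτ k (List.ne_nil_of_mem hk)
      rw [hτψ j' hj'] at hk
      rw [huniq hk hj]
  have hsumτ : ∑ k, I.excess k (τ k) = ∑ j ∈ X, I.excess (ψ j) (σ j) := by
    rw [← Finset.sum_subset (Finset.subset_univ (X.image ψ)), Finset.sum_image hψ]
    · exact Finset.sum_congr rfl fun j hj => by rw [hτψ j hj]
    · intro k _ hk
      have : τ k = [] := by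
        by_contra hne
        obtain ⟨j, hj, rfl⟩ := hτ k hne
        exact hk (Finset.mem_image_of_mem _ hj)
      simp [this]
  have hsumσ : ∑ k, I.excess k (σ k) = ∑ j ∈ X, I.excess j (σ j) :=
    (Finset.sum_subset (Finset.subset_univ X) fun j _ hj => by
      have : σ j = [] := by simpa [hX] using hj
      simp [this]).symm
  have hlen : I.totalLength τ ≤ I.totalLength σ := by
    rw [totalLength_eq, totalLength_eq, hsumτ, hsumσ]
    have key : ∀ ρ : Fin (m + l) → Fin (m + l), ∑ j ∈ X, I.excess (ρ j) (σ j)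
        = ∑ j ∈ X, I.detour (ty j) (ρ j) + ∑ j ∈ X, (polyLength ((σ j).map I.V)
          - dist (I.V (ty j).1) (I.V (ty j).2)) := fun ρ => by
      rw [← Finset.sum_add_distrib]
      refine Finset.sum_congr rfl fun j hj => ?_
      rw [excess_eq _ _ _ ((hX j).1 hj), hty j ((hX j).1 hj)]
    have h₁ := key ψ
    have h₂ := key id
    simp only [id] at h₂
    linarith
  refine ⟨τ, ⟨hτsol, fun ρ hρ => hlen.trans (hopt ρ hρ)⟩, fun k hk => ?_⟩
  by_contra hne
  obtain ⟨j, hj, rfl⟩ := hτ k hne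
  exact hk (hψM j hj)

end Data

/-! ### The Hungarian method on rows and columns numbered by natural numbers -/

/-- `e` encodes a minimizer of `f` on `P`: it is `0` if `P` is empty, and otherwise it is the
minimizer plus one. -/
def IsArgmin (f : ℕ → ℝ) (P : Set ℕ) (e : ℕ) : Prop :=
  (e = 0 ∧ P = ∅) ∨ ∃ k, e = k + 1 ∧ k ∈ P ∧ ∀ j ∈ P, f k ≤ f j

namespace IsArgmin

variable {f : ℕ → ℝ} {P Q : Set ℕ} {e e' : ℕ}

theorem union_right (h : IsArgmin f P e) (h' : IsArgmin f Q e') (he' : e' ≠ 0)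
    (hlt : e = 0 ∨ f (e' - 1) < f (e - 1)) : IsArgmin f (P ∪ Q) e' := by
  obtain ⟨h₀, -⟩ | ⟨k', rfl, hk', hmin'⟩ := h'
  · exact absurd h₀ he'
  refine .inr ⟨k', rfl, .inr hk', ?_⟩
  rintro j (hj | hj)
  · obtain ⟨rfl, rfl⟩ | ⟨k, rfl, hk, hmin⟩ := h
    · exact hj.elim
    · have := hlt.resolve_left k.succ_ne_zero
      simp only [Nat.add_sub_cancel] at this
      exact this.le.trans (hmin j hj)
  · exact hmin' j hj

theorem union_left (h : IsArgmin f P e) (h' : IsArgmin f Q e')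
    (hlt : ¬ (e' ≠ 0 ∧ (e = 0 ∨ f (e' - 1) < f (e - 1)))) : IsArgmin f (P ∪ Q) e := by
  obtain ⟨rfl, rfl⟩ | ⟨k', rfl, hk', hmin'⟩ := h'
  · simpa using h
  push Not at hlt
  have hlt := hlt k'.succ_ne_zero
  obtain ⟨rfl, rfl⟩ | ⟨k, rfl, hk, hmin⟩ := h
  · exact absurd rfl hlt.1
  · refine .inr ⟨k, rfl, .inl hk, ?_⟩
    rintro j (hj | hj)
    · exact hmin j hj
    · have := hlt.2
      simp only [Nat.add_sub_cancel] at this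
      exact this.trans (hmin' j hj)

theorem ne_zero (h : IsArgmin f P e) (hP : P.Nonempty) : e ≠ 0 := by
  obtain ⟨-, rfl⟩ | ⟨k, rfl, -⟩ := h
  · exact absurd hP (by simp)
  · simp

theorem mem (h : IsArgmin f P e) (he : e ≠ 0) : e - 1 ∈ P := by
  obtain ⟨h₀, -⟩ | ⟨k, rfl, hk, -⟩ := h
  · exact absurd h₀ he
  · exact hk

theorem le (h : IsArgmin f P e) {j : ℕ} (hj : j ∈ P) : f (e - 1) ≤ f j := by
  obtain ⟨-, rfl⟩ | ⟨k, rfl, -, hmin⟩ := h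
  · exact hj.elim
  · exact hmin j hj

end IsArgmin

namespace Data

variable {n m l : ℕ} (I : Data n m l)

/-- The point whose coordinates are the cells with address `i` in the arrays `a` and `a + 1` of the
input. -/
def inputPoint (a i : ℕ) : Plane := !₂[I.input.rarr a i, I.input.rarr (a + 1) i]

/-- The cost of assigning the pair (column) `j` to the row `a`, which stands for the ordered pair of
the inner points with the numbers `a / n` and `a % n`: the length of the detour. -/
def cost (a j : ℕ) : ℝ :=
  dist (I.inputPoint 2 j) (I.inputPoint 0 (a / n))
    + dist (I.inputPoint 0 (a / n)) (I.inputPoint 0 (a % n))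
    + dist (I.inputPoint 0 (a % n)) (I.inputPoint 4 j)
    - dist (I.inputPoint 2 j) (I.inputPoint 4 j)

theorem cost_nonneg (a j : ℕ) : 0 ≤ I.cost a j := by
  have h₁ := dist_triangle (I.inputPoint 2 j) (I.inputPoint 0 (a / n)) (I.inputPoint 4 j)
  have h₂ := dist_triangle (I.inputPoint 0 (a / n)) (I.inputPoint 0 (a % n)) (I.inputPoint 4 j)
  unfold cost
  linarith

theorem cost_eq_detour (a : Fin n × Fin n) (j : Fin (m + l)) :
    I.cost (a.1 * n + a.2) j = I.detour a j := by
  have hn : 0 < n := a.1.pos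
  have h₁ : (a.1 * n + a.2 : ℕ) / n = a.1 := by
    rw [mul_comm, Nat.mul_add_div hn, Nat.div_eq_of_lt a.2.2, add_zero]
  have h₂ : (a.1 * n + a.2 : ℕ) % n = a.2 := by
    rw [mul_comm, Nat.mul_add_mod, Nat.mod_eq_of_lt a.2.2]
  have hV : ∀ i : Fin n, I.inputPoint 0 i = I.V i := fun i => by
    ext k; fin_cases k <;> simp [inputPoint, input, arrayOf]
  have hP : I.inputPoint 2 j = (I.pair j).1 := by
    ext k; fin_cases k <;> simp [inputPoint, input, arrayOf]
  have hP' : I.inputPoint 4 j = (I.pair j).2 := by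
    ext k; fin_cases k <;> simp [inputPoint, input, arrayOf]
  rw [cost, h₁, h₂, hV, hV, hP, hP', detour]

/-- The number of blocks of `n * n` columns; the last block may be incomplete. -/
def numBlocks (_ : Data n m l) : ℕ := (m + l) / (n * n) + 1

/-- The free columns in the block `b`. -/
def freeIn (_ : Data n m l) (free : ℕ → ℕ) (b : ℕ) : Set ℕ :=
  {j | j < m + l ∧ free j = 1 ∧ j / (n * n) = b}

/-- The rows below `i` are matched by `M` to different columns, and the other columns are marked as
free. -/
structure Matching (_ : Data n m l) (i : ℕ) (M free : ℕ → ℕ) : Prop where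
  lt : ∀ a < i, M a < m + l
  inj : ∀ a < i, ∀ b < i, M a = M b → a = b
  free_iff : ∀ j < m + l, free j = 1 ↔ ∀ a < i, M a ≠ j

/-- The table of the best free column for each row in each block is correct. -/
def IsTable (free best : ℕ → ℕ) : Prop :=
  ∀ t < n * n * I.numBlocks,
    IsArgmin (I.cost (t / I.numBlocks)) (I.freeIn free (t % I.numBlocks)) (best t)

/-- The potentials `u` of the rows and `v` of the columns are feasible, the edges of the matching `M`
of the rows below `i` are tight, and the potentials of the free columns vanish. -/
structure Dual (i : ℕ) (M free : ℕ → ℕ) (u v : ℕ → ℝ) : Prop where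
  feas : ∀ a, ∀ j < m + l, u a + v j ≤ I.cost a j
  tight : ∀ a < i, u a + v (M a) = I.cost a (M a)
  nonpos : ∀ j, v j ≤ 0
  zero : ∀ j < m + l, free j = 1 → v j = 0

/-- The alternating tree of the phase `i`. Its rows are those with `used a = i + 1`; its root is the
row `i`. The column that is matched to a tree row `a ≠ i` is joined to the parent row `way a` by a
tight edge. The ghost function `ρ` gives the time when a row was added. -/
structure Tree (i : ℕ) (M used way ρ : ℕ → ℕ) (u v : ℕ → ℝ) : Prop where
  le : ∀ a, used a = i + 1 → a ≤ i
  root : used i = i + 1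
  way : ∀ a, used a = i + 1 → a ≠ i → used (way a) = i + 1 ∧ ρ (way a) < ρ a ∧
    u (way a) + v (M a) = I.cost (way a) (M a)

/-- The tree rows in `R` have been scanned: for each row `a` outside the tree, `D a` is the least
slack of the edges from `R` to the column of `a`, attained at `way a`, and `μ` is the least slack of
the edges from `R` to the free columns, attained at the edge from `g` to `f`. -/
structure Scanned (i : ℕ) (R : Set ℕ) (M free used way : ℕ → ℕ) (u v D : ℕ → ℝ) (μ : ℝ)
    (f g : ℕ) : Prop where
  D_le : ∀ a < i, used a ≠ i + 1 → ∀ b ∈ R, D a ≤ I.cost b (M a) - u b - v (M a)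
  D_eq : R.Nonempty → ∀ a < i, used a ≠ i + 1 →
    way a ∈ R ∧ D a = I.cost (way a) (M a) - u (way a) - v (M a)
  μ_le : ∀ b ∈ R, ∀ j < m + l, free j = 1 → μ ≤ I.cost b j - u b
  μ_eq : R.Nonempty → g ∈ R ∧ f < m + l ∧ free f = 1 ∧ μ = I.cost g f - u g

variable {I}

variable {i : ℕ} {M free used way ρ : ℕ → ℕ} {u v D : ℕ → ℝ} {μ δ : ℝ} {f g : ℕ}

/-- Changing the potentials by at most the least slack `δ` of the edges that leave the tree. -/
theorem Scanned.shift (hM : I.Matching i M free) (hd : I.Dual i M free u v)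
    (ht : I.Tree i M used way ρ u v)
    (hs : I.Scanned i {b | used b = i + 1} M free used way u v D μ f g)
    (h₀ : 0 ≤ δ) (hD : ∀ a < i, used a ≠ i + 1 → δ ≤ D a) (hμ : δ ≤ μ)
    {u' D' : ℕ → ℝ} (hu : ∀ a, used a = i + 1 → u' a = u a + δ)
    (hu' : ∀ a, used a ≠ i + 1 → u' a = u a) (hD' : ∀ a < i, used a ≠ i + 1 → D' a = D a - δ) :
    ∃ v', I.Dual i M free u' v' ∧ I.Tree i M used way ρ u' v' ∧
      I.Scanned i {b | used b = i + 1} M free used way u' v' D' (μ - δ) f g := by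
  classical
  have hne : {b | used b = i + 1}.Nonempty := ⟨i, ht.root⟩
  -- the columns of the tree, whose potentials go down
  let T : Set ℕ := {j | ∃ a < i, used a = i + 1 ∧ M a = j}
  let v' : ℕ → ℝ := fun j => if j ∈ T then v j - δ else v j
  have hT : ∀ j, j ∈ T → v' j = v j - δ := fun j hj => by simp [v', hj]
  have hT' : ∀ j, j ∉ T → v' j = v j := fun j hj => by simp [v', hj]
  have hMT : ∀ a < i, used a = i + 1 → v' (M a) = v (M a) - δ := fun a ha h => hT _ ⟨a, ha, h, rfl⟩
  have hMT' : ∀ a < i, used a ≠ i + 1 → v' (M a) = v (M a) := fun a ha h => by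
    refine hT' _ ?_
    rintro ⟨b, hb, hub, hab⟩
    exact h (hM.inj b hb a ha hab ▸ hub)
  have hfree : ∀ j < m + l, free j = 1 → v' j = v j := fun j hj hf => by
    refine hT' _ ?_
    rintro ⟨b, hb, -, hab⟩
    exact (hM.free_iff j hj).1 hf b hb hab
  refine ⟨v', ⟨?_, ?_, ?_, ?_⟩, ⟨ht.le, ht.root, ?_⟩, ⟨?_, ?_, ?_, ?_⟩⟩
  · intro a j hj
    have hf := hd.feas a j hj
    by_cases ha : used a = i + 1
    · rw [hu a ha]
      by_cases hfj : free j = 1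
      · have := hs.μ_le a ha j hj hfj
        rw [hfree j hj hfj, hd.zero j hj hfj]
        linarith
      · rw [hM.free_iff j hj] at hfj
        push Not at hfj
        obtain ⟨b, hb, rfl⟩ := hfj
        by_cases hub : used b = i + 1
        · rw [hMT b hb hub]; linarith
        · have := hs.D_le b hb hub a ha
          have := hD b hb hub
          rw [hMT' b hb hub]; linarith
    · rw [hu' a ha]
      have : v' j ≤ v j := by simp only [v']; split_ifs <;> linarith
      linarith
  · intro a ha
    have := hd.tight a ha
    by_cases hua : used a = i + 1
    · rw [hu a hua, hMT a ha hua]; linarith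
    · rw [hu' a hua, hMT' a ha hua]; linarith
  · intro j
    have := hd.nonpos j
    simp only [v']; split_ifs <;> linarith
  · intro j hj hf
    rw [hfree j hj hf, hd.zero j hj hf]
  · intro a ha hai
    obtain ⟨h₁, h₂, h₃⟩ := ht.way a ha hai
    refine ⟨h₁, h₂, ?_⟩
    rw [hu _ h₁, hMT a (lt_of_le_of_ne (ht.le a ha) hai) ha]; linarith
  · intro a ha hua b hb
    have := hs.D_le a ha hua b hb
    rw [hD' a ha hua, hu b hb, hMT' a ha hua]; linarith
  · intro _ a ha hua
    obtain ⟨h₁, h₂⟩ := hs.D_eq hne a ha hua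
    refine ⟨h₁, ?_⟩
    rw [hD' a ha hua, hu _ h₁, hMT' a ha hua]; linarith
  · intro b hb j hj hf
    have := hs.μ_le b hb j hj hf
    rw [hu b hb]; linarith
  · intro _
    obtain ⟨h₁, h₂, h₃, h₄⟩ := hs.μ_eq hne
    refine ⟨h₁, h₂, h₃, ?_⟩
    rw [hu g h₁]; linarith

/-- Adding a row `r` whose column is joined to the tree by a tight edge. -/
theorem Tree.insert (ht : I.Tree i M used way ρ u v)
    (hs : I.Scanned i {b | used b = i + 1} M free used way u v D μ f g) {r : ℕ} (hr : r < i)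
    (hur : used r ≠ i + 1) (h₀ : D r = 0) {k : ℕ} (hk : ∀ a, used a = i + 1 → ρ a < k) :
    I.Tree i M (Function.update used r (i + 1)) way (Function.update ρ r k) u v ∧
    I.Scanned i {b | Function.update used r (i + 1) b = i + 1 ∧ b ≠ r} M free
      (Function.update used r (i + 1)) way u v D μ f g := by
  have hne : {b | used b = i + 1}.Nonempty := ⟨i, ht.root⟩
  have hR : {b | Function.update used r (i + 1) b = i + 1 ∧ b ≠ r} = {b | used b = i + 1} := by
    ext b
    by_cases hb : b = r
    · subst hb; simp [hur]
    · simp [hb]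
  have hmono : ∀ a, used a = i + 1 → Function.update used r (i + 1) a = i + 1 := fun a ha => by
    by_cases hb : a = r <;> simp [hb, ha]
  have hold : ∀ a, a ≠ r → Function.update used r (i + 1) a = used a := fun a ha => by simp [ha]
  refine ⟨⟨?_, hmono _ ht.root, ?_⟩, ?_⟩
  · intro a ha
    by_cases hb : a = r
    · exact hb ▸ hr.le
    · exact ht.le a (hold a hb ▸ ha)
  · intro a ha hai
    by_cases hb : a = r
    · subst hb
      obtain ⟨h₁, h₂⟩ := hs.D_eq hne a hr hur
      refine ⟨hmono _ h₁, ?_, by linarith⟩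
      have : way a ≠ a := fun h => hur (h ▸ h₁)
      simpa [this] using hk _ h₁
    · rw [hold a hb] at ha
      obtain ⟨h₁, h₂, h₃⟩ := ht.way a ha hai
      refine ⟨hmono _ h₁, ?_, h₃⟩
      have : way a ≠ r := fun h => hur (h ▸ h₁)
      simpa [this, hb] using h₂
  · rw [hR]
    have hw : ∀ a, Function.update used r (i + 1) a ≠ i + 1 → used a ≠ i + 1 := fun a ha h =>
      ha (hmono a h)
    exact ⟨fun a ha hua => hs.D_le a ha (hw a hua), fun h a ha hua => hs.D_eq h a ha (hw a hua),
      hs.μ_le, hs.μ_eq⟩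

/-- The matching stays a matching when the columns of two rows are exchanged. -/
theorem Matching.swap (hM : I.Matching i M free) {a b : ℕ} (ha : a < i) (hb : b < i) :
    I.Matching i (Function.update (Function.update M a (M b)) b (M a)) free := by
  have key : Function.update (Function.update M a (M b)) b (M a) = M ∘ Equiv.swap a b := by
    ext x
    simp only [Function.update_apply, Function.comp_apply, Equiv.swap_apply_def]
    split_ifs <;> simp_all
  have hlt : ∀ x < i, Equiv.swap a b x < i := fun x hx => by
    rw [Equiv.swap_apply_def]; split_ifs <;> assumption
  rw [key]
  refine ⟨fun x hx => hM.lt _ (hlt x hx), fun x hx y hy h =>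
    (Equiv.swap a b).injective (hM.inj _ (hlt x hx) _ (hlt y hy) h), fun j hj => ?_⟩
  rw [hM.free_iff j hj]
  refine ⟨fun h x hx => h _ (hlt x hx), fun h x hx => ?_⟩
  simpa using h _ (hlt x hx)

/-- Matching one more row to a free column. -/
theorem Matching.extend (hM : I.Matching i M free) (hf : f < m + l) (hfree : free f = 1) :
    I.Matching (i + 1) (Function.update M i f) (Function.update free f 0) := by
  have hne := (hM.free_iff f hf).1 hfree
  have hold : ∀ a < i, Function.update M i f a = M a := fun a ha =>
    Function.update_of_ne ha.ne _ _
  refine ⟨fun a ha => ?_, fun a ha b hb h => ?_, fun j hj => ?_⟩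
  · rcases Nat.lt_succ_iff_lt_or_eq.1 ha with ha | rfl
    · rw [hold a ha]; exact hM.lt a ha
    · simpa using hf
  · rcases Nat.lt_succ_iff_lt_or_eq.1 ha with ha | rfl <;>
      rcases Nat.lt_succ_iff_lt_or_eq.1 hb with hb | rfl
    · rw [hold a ha, hold b hb] at h; exact hM.inj a ha b hb h
    · rw [hold a ha, Function.update_self] at h; exact absurd h (hne a ha)
    · rw [hold b hb, Function.update_self] at h; exact absurd h.symm (hne b hb)
    · rfl
  · by_cases hjf : j = f
    · subst hjf
      simp only [Function.update_self, zero_ne_one, false_iff]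
      exact fun h => h i (Nat.lt_succ_self i) (by simp)
    · rw [Function.update_of_ne hjf, hM.free_iff j hj]
      refine ⟨fun h a ha => ?_, fun h a ha => by simpa [hold a ha] using h a (by omega)⟩
      rcases Nat.lt_succ_iff_lt_or_eq.1 ha with ha | rfl
      · rw [hold a ha]; exact h a ha
      · simpa using Ne.symm hjf

open Classical in
/-- Scanning the tree row `r`: the least slacks are compared with those of the edges from `r`. The
best free column for `r` is `e`, and `x a` is the slack of the edge from `r` to the column of `a`. -/
theorem Scanned.scan (hd : I.Dual i M free u v) (ht : I.Tree i M used way ρ u v) {r : ℕ}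
    (hr : used r = i + 1) (hroot : r = i → ∀ b, used b = i + 1 → b = i)
    (hs : I.Scanned i {b | used b = i + 1 ∧ b ≠ r} M free used way u v D μ f g) {e : ℕ}
    (he : e < m + l) (hfe : free e = 1)
    (hmin : ∀ j < m + l, free j = 1 → I.cost r e ≤ I.cost r j) {x D' : ℕ → ℝ}
    (hx : ∀ a, x a = I.cost r (M a) - u r - (I.cost a (M a) - u a)) {way' : ℕ → ℕ}
    (hD' : D' = fun a => if a < i ∧ used a ≠ i + 1 ∧ (r = i ∨ x a < D a) then x a else D a)
    (hway' : way' = fun a => if a < i ∧ used a ≠ i + 1 ∧ (r = i ∨ x a < D a) then r else way a)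
    {μ' : ℝ} {f' g' : ℕ}
    (h : ((r = i ∨ I.cost r e - u r < μ) ∧ μ' = I.cost r e - u r ∧ f' = e ∧ g' = r) ∨
      ((r ≠ i ∧ μ ≤ I.cost r e - u r) ∧ μ' = μ ∧ f' = f ∧ g' = g)) :
    I.Scanned i {b | used b = i + 1} M free used way' u v D' μ' f' g' ∧
      I.Tree i M used way' ρ u v := by
  have hx' : ∀ a < i, x a = I.cost r (M a) - u r - v (M a) := fun a ha => by
    rw [hx, ← hd.tight a ha]; ring
  have hne : r ≠ i → {b | used b = i + 1 ∧ b ≠ r}.Nonempty := fun hri => ⟨i, ht.root, hri.symm⟩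
  have hold : r = i → ∀ b ∈ {b | used b = i + 1 ∧ b ≠ r}, False := fun hri b hb =>
    hb.2 ((hroot hri b hb.1).trans hri.symm)
  refine ⟨⟨?_, ?_, ?_, ?_⟩, ht.le, ht.root, fun a ha => ?_⟩
  · intro a ha hua b hb
    by_cases hbr : b = r
    · subst hbr
      rw [← hx' a ha, hD']
      dsimp only
      split_ifs with hc
      · exact le_rfl
      · exact not_lt.1 fun hlt => hc ⟨ha, hua, .inr hlt⟩
    · have := hs.D_le a ha hua b ⟨hb, hbr⟩
      rw [hD']
      dsimp only
      split_ifs with hc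
      · obtain hri | hlt := hc.2.2
        · exact (hold hri b ⟨hb, hbr⟩).elim
        · exact hlt.le.trans this
      · exact this
  · intro _ a ha hua
    simp only [hD', hway']
    split_ifs with hc
    · exact ⟨hr, hx' a ha⟩
    · have hri : r ≠ i := fun hri => hc ⟨ha, hua, .inl hri⟩
      obtain ⟨h₁, h₂⟩ := hs.D_eq (hne hri) a ha hua
      exact ⟨h₁.1, h₂⟩
  · intro b hb j hj hfj
    obtain ⟨hc, rfl, -, -⟩ | ⟨hc, rfl, -, -⟩ := h
    · by_cases hbr : b = r
      · subst hbr
        linarith [hmin j hj hfj]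
      · obtain hri | hlt := hc
        · exact (hold hri b ⟨hb, hbr⟩).elim
        · exact hlt.le.trans (hs.μ_le b ⟨hb, hbr⟩ j hj hfj)
    · by_cases hbr : b = r
      · subst hbr
        linarith [hmin j hj hfj]
      · exact hs.μ_le b ⟨hb, hbr⟩ j hj hfj
  · intro _
    obtain ⟨hc, rfl, rfl, rfl⟩ | ⟨hc, rfl, rfl, rfl⟩ := h
    · exact ⟨hr, he, hfe, rfl⟩
    · obtain ⟨h₁, h₂⟩ := hs.μ_eq (hne hc.1)
      exact ⟨h₁.1, h₂⟩
  · have : way' a = way a := by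
      rw [hway']
      exact if_neg fun hc => hc.2.1 ha
    rw [this]
    exact ht.way a ha

/-- The situation while the matching is changed along the path from the row `r` to the root `i` of
the tree. The column that is to be given to `r` is kept as the column of `i`, and on the rest of the
path the matching is still the original one, `M₀`. -/
structure Augmenting (I : Data n m l) (i : ℕ) (M₀ M free used ρ : ℕ → ℕ) (u v : ℕ → ℝ) (r : ℕ) :
    Prop where
  matching : I.Matching (i + 1) M free
  tight : ∀ a < i, u a + v (M a) = I.cost a (M a)
  mem : used r = i + 1
  tight_row : u r + v (M i) = I.cost r (M i)
  orig : ∀ a, used a = i + 1 → ρ a ≤ ρ r → a ≠ i → M a = M₀ a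

theorem Augmenting.start (hM : I.Matching i M free) (hd : I.Dual i M free u v)
    (hg : used g = i + 1) (hf : f < m + l) (hfree : free f = 1) (h : I.cost g f - u g = 0) :
    I.Augmenting i M (Function.update M i f) (Function.update free f 0) used ρ u v g := by
  refine ⟨hM.extend hf hfree, fun a ha => ?_, hg, ?_, fun a _ _ ha => by simp [ha]⟩
  · rw [Function.update_of_ne ha.ne]; exact hd.tight a ha
  · rw [Function.update_self, hd.zero f hf hfree]; linarith

theorem Augmenting.step {M₀ : ℕ → ℕ} {r : ℕ} (ht : I.Tree i M₀ used way ρ u v)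
    (h : I.Augmenting i M₀ M free used ρ u v r) (hr : r ≠ i) :
    ρ (way r) < ρ r ∧ I.Augmenting i M₀ (Function.update (Function.update M r (M i)) i (M r))
      free used ρ u v (way r) := by
  obtain ⟨h₁, h₂, h₃⟩ := ht.way r h.mem hr
  have hri : r < i := lt_of_le_of_ne (ht.le r h.mem) hr
  refine ⟨h₂, h.matching.swap (by omega) (by omega), fun a ha => ?_, h₁, ?_, fun a hua ha hai => ?_⟩
  · rw [Function.update_of_ne ha.ne]
    by_cases har : a = r
    · subst har; simpa using h.tight_row
    · rw [Function.update_of_ne har]; exact h.tight a ha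
  · rw [Function.update_self, h.orig r h.mem le_rfl hr]; exact h₃
  · have har : a ≠ r := by rintro rfl; omega
    rw [Function.update_of_ne hai, Function.update_of_ne har]
    exact h.orig a hua (by omega) hai

theorem Augmenting.finish {M₀ free₀ : ℕ → ℕ} (hd : I.Dual i M₀ free₀ u v)
    (h : I.Augmenting i M₀ M (Function.update free₀ f 0) used ρ u v i) :
    I.Dual (i + 1) M (Function.update free₀ f 0) u v := by
  refine ⟨hd.feas, fun a ha => ?_, hd.nonpos, fun j hj hf => hd.zero j hj ?_⟩
  · rcases Nat.lt_succ_iff_lt_or_eq.1 ha with ha | rfl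
    exacts [h.tight a ha, h.tight_row]
  · by_cases hjf : j = f
    · subst hjf; simp at hf
    · simpa [hjf] using hf

/-! ### The memory of the program

The input uses the integer registers `xn`, `xm`, `xl` and the real arrays `0`, …, `5`. The
names of the other registers and arrays have the following meaning.

* Parameters: `xN` is the number of columns, `xK` the number of rows, `xB` the number of blocks, and
  `xQ` the size of the table.
* The phase: `xi` is the root, `xp = xi + 1` is the stamp of the tree rows, `xr` is the current row,
  `xd` tells whether the search is over, `yM` is the least slack from the tree to the free columns,
  attained between the row `xg` and the column `xf`, `xs` is one plus the row to be added next, `yD` is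
  the shift of the potentials, and `xc` is the block to be recomputed.
* Auxiliary registers: `xt`, `xa`, `xb`, `xe`, `xk`, `xj`, `xh`, `yX`.
* Integer arrays: `aF` marks the free columns, `aM` is the matching, `aT` holds the stamps of the rows,
  `aW` the parents in the tree, and `aB` the table.
* Real arrays: `bU` holds the potentials of the rows, and `bD` the least slacks of their columns.

The time bounds are generous: up to `1000` units are charged for a loop-free step.
-/

section Programs

open RealRAM RealRAM.Prog

local notation "xn" => (0 : ℕ)
local notation "xm" => (1 : ℕ)
local notation "xl" => (2 : ℕ)
local notation "xN" => (3 : ℕ)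
local notation "xK" => (4 : ℕ)
local notation "xB" => (5 : ℕ)
local notation "xi" => (6 : ℕ)
local notation "xr" => (7 : ℕ)
local notation "xs" => (8 : ℕ)
local notation "xd" => (9 : ℕ)
local notation "xf" => (10 : ℕ)
local notation "xg" => (11 : ℕ)
local notation "xt" => (12 : ℕ)
local notation "xa" => (13 : ℕ)
local notation "xb" => (14 : ℕ)
local notation "xe" => (15 : ℕ)
local notation "xk" => (16 : ℕ)
local notation "xj" => (17 : ℕ)
local notation "xp" => (18 : ℕ)
local notation "xQ" => (19 : ℕ)
local notation "xc" => (20 : ℕ)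
local notation "xh" => (21 : ℕ)
local notation "yM" => (0 : ℕ)
local notation "yD" => (1 : ℕ)
local notation "yX" => (2 : ℕ)
local notation "aF" => (0 : ℕ)
local notation "aM" => (1 : ℕ)
local notation "aT" => (2 : ℕ)
local notation "aW" => (3 : ℕ)
local notation "aB" => (4 : ℕ)
local notation "bU" => (6 : ℕ)
local notation "bD" => (7 : ℕ)

/-! ### Expressions and the fixed part of the memory -/

/-- The disjunction of two tests. -/
def orTest (b c : Test) : Test := .not (.and (.not b) (.not c))

/-- The distance of the points with the coordinates `(x, y)` and `(x', y')`. -/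
def distExp (x y x' y' : RExp) : RExp :=
  .sqrt (.add (.mul (.sub x x') (.sub x x')) (.mul (.sub y y') (.sub y y')))

/-- The distance of the point at address `e` of the arrays `a`, `a + 1` and the point at address `f`
of the arrays `b`, `b + 1`. -/
def pointDistExp (a : ℕ) (e : IExp) (b : ℕ) (f : IExp) : RExp :=
  distExp (.get a e) (.get (a + 1) e) (.get b f) (.get (b + 1) f)

/-- The cost of assigning the column `f` to the row `e`. -/
def costExp (e f : IExp) : RExp :=
  .sub (.add (.add (pointDistExp 2 f 0 (.div e (.reg xn)))
    (pointDistExp 0 (.div e (.reg xn)) 0 (.mod e (.reg xn))))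
    (pointDistExp 0 (.mod e (.reg xn)) 4 f)) (pointDistExp 2 f 4 f)

theorem pointDistExp_eval {s : State} {a b : ℕ} {e f : IExp}
    (ha : s.rarr a = I.input.rarr a) (ha' : s.rarr (a + 1) = I.input.rarr (a + 1))
    (hb : s.rarr b = I.input.rarr b) (hb' : s.rarr (b + 1) = I.input.rarr (b + 1)) :
    (pointDistExp a e b f).eval s = dist (I.inputPoint a (e.eval s)) (I.inputPoint b (f.eval s)) := by
  rw [EuclideanSpace.dist_eq]
  simp [pointDistExp, distExp, RExp.eval, inputPoint, ha, ha', hb, hb', Real.dist_eq, pow_two]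

theorem pointDistExp_ok {S W : ℕ} {s : State} {a b : ℕ} {e f : IExp} (he : e.Ok S W s)
    (hf : f.Ok S W s) (he' : e.eval s < S) (hf' : f.eval s < S) :
    (pointDistExp a e b f).Ok S W s := by
  refine ⟨?_, add_nonneg (mul_self_nonneg _) (mul_self_nonneg _)⟩
  simp [RExp.Ok, he, hf, he', hf']

theorem costExp_eval {s : State} {e f : IExp} (hn : s.ireg xn = n)
    (h0 : s.rarr 0 = I.input.rarr 0) (h1 : s.rarr 1 = I.input.rarr 1)
    (h2 : s.rarr 2 = I.input.rarr 2) (h3 : s.rarr 3 = I.input.rarr 3)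
    (h4 : s.rarr 4 = I.input.rarr 4) (h5 : s.rarr 5 = I.input.rarr 5) :
    (costExp e f).eval s = I.cost (e.eval s) (f.eval s) := by
  simp only [costExp, RExp.eval, cost]
  rw [pointDistExp_eval h2 h3 h0 h1, pointDistExp_eval h0 h1 h0 h1, pointDistExp_eval h0 h1 h4 h5,
    pointDistExp_eval h2 h3 h4 h5]
  simp only [IExp.eval, hn]

theorem costExp_ok {S W : ℕ} {s : State} {e f : IExp} (hn : s.ireg xn = n) (hnS : n ≤ S)
    (he : e.Ok S W s) (hf : f.Ok S W s) (he' : e.eval s < n * n) (hf' : f.eval s < S) :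
    (costExp e f).Ok S W s := by
  have hn0 : 0 < n := by
    rcases Nat.eq_zero_or_pos n with rfl | h
    · simp at he'
    · exact h
  have h₁ : (IExp.div e (.reg xn)).Ok S W s := ⟨he, trivial, by simpa [IExp.eval, hn] using hn0.ne'⟩
  have h₂ : (IExp.mod e (.reg xn)).Ok S W s := ⟨he, trivial, by simpa [IExp.eval, hn] using hn0.ne'⟩
  have h₃ : (IExp.div e (.reg xn)).eval s < S := by
    simp only [IExp.eval, hn]
    exact lt_of_lt_of_le (Nat.div_lt_of_lt_mul he') hnS
  have h₄ : (IExp.mod e (.reg xn)).eval s < S := by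
    simp only [IExp.eval, hn]
    exact lt_of_lt_of_le (Nat.mod_lt _ hn0) hnS
  exact ⟨⟨⟨pointDistExp_ok hf h₁ hf' h₃, pointDistExp_ok h₁ h₂ h₃ h₄⟩,
    pointDistExp_ok h₂ hf h₄ hf'⟩, pointDistExp_ok hf hf hf' hf'⟩

/-- The input and the fixed parameters in the memory, with sufficient bounds for addresses and
integers. -/
structure Env (I : Data n m l) (S W : ℕ) (s : State) : Prop where
  lt : n * n < m + l
  S_ge : 4 * (m + l) ≤ S
  W_ge : 4 * (m + l) ≤ W
  xn_eq : s.ireg xn = n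
  xN_eq : s.ireg xN = m + l
  xK_eq : s.ireg xK = n * n
  xB_eq : 0 < n → s.ireg xB = I.numBlocks
  xQ_eq : s.ireg xQ = n * n * I.numBlocks
  arr0 : s.rarr 0 = I.input.rarr 0
  arr1 : s.rarr 1 = I.input.rarr 1
  arr2 : s.rarr 2 = I.input.rarr 2
  arr3 : s.rarr 3 = I.input.rarr 3
  arr4 : s.rarr 4 = I.input.rarr 4
  arr5 : s.rarr 5 = I.input.rarr 5

theorem Env.of_frame {S W : ℕ} {p : Prog} {s s' : State} (h : I.Env S W s) (hF : p.Frame s s')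
    (h₁ : ∀ x ∈ [0, 3, 4, 5, 19], x ∉ p.iregs) (h₂ : ∀ a ∈ [0, 1, 2, 3, 4, 5], a ∉ p.rarrs) :
    I.Env S W s' := by
  have e : ∀ x ∈ [0, 3, 4, 5, 19], s'.ireg x = s.ireg x := fun x hx => hF.ireg x (h₁ x hx)
  have e' : ∀ a ∈ [0, 1, 2, 3, 4, 5], s'.rarr a = s.rarr a := fun a ha => hF.rarr a (h₂ a ha)
  simp only [List.mem_cons, List.not_mem_nil, or_false, forall_eq_or_imp, forall_eq] at e e'
  obtain ⟨e0, e3, e4, e5, e19⟩ := e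
  obtain ⟨f0, f1, f2, f3, f4, f5⟩ := e'
  exact ⟨h.lt, h.S_ge, h.W_ge, e0.trans h.xn_eq, e3.trans h.xN_eq, e4.trans h.xK_eq,
    fun hn => e5.trans (h.xB_eq hn), e19.trans h.xQ_eq, f0.trans h.arr0, f1.trans h.arr1,
    f2.trans h.arr2, f3.trans h.arr3, f4.trans h.arr4, f5.trans h.arr5⟩

/-! ### The table of the best free columns -/

/-- One step of the search for a best free column in a block. A test evaluates all of its parts; as
`0 - 1 = 0`, the comparison of costs is harmless for `xe = 0`, and `xj` stays below `2 * xN`. -/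
def blockMinStep : Prog :=
  .seq (.iset xj (.add (.mul (.reg xb) (.reg xK)) (.reg xk)))
    (.cond (.and (.and (.ilt (.reg xj) (.reg xN)) (.ieq (.get aF (.reg xj)) (.const 1)))
        (orTest (.ieq (.reg xe) (.const 0))
          (.rlt (costExp (.reg xa) (.reg xj)) (costExp (.reg xa) (.sub (.reg xe) (.const 1))))))
      (.iset xe (.add (.reg xj) (.const 1))) .skip)

/-- Computes the entry `xt` of the table of the best free columns in the blocks. -/
def blockMin : Prog :=
  .seq (.seq (.iset xa (.div (.reg xt) (.reg xB)))
    (.seq (.iset xb (.mod (.reg xt) (.reg xB))) (.iset xe (.const 0)))) <|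
  .seq (forLoop xk xK blockMinStep) (.iput aB (.reg xt) (.reg xe))

theorem numBlocks_mul_le (h : n * n < m + l) : n * n * I.numBlocks ≤ 2 * (m + l) := by
  have := Nat.mul_div_le (m + l) (n * n)
  rw [numBlocks, mul_add]
  omega

theorem Env.n_le {S W : ℕ} {s : State} (h : I.Env S W s) : n ≤ S := by
  have := h.lt
  have := h.S_ge
  have : n ≤ n * n := Nat.le_mul_self n
  omega

theorem blockMinStep_runs {S W : ℕ} {s : State} (hE : I.Env S W s) {a b k : ℕ}
    (ha : a < n * n) (hb : b < I.numBlocks) (hk : k < n * n) (hsa : s.ireg xa = a)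
    (hsb : s.ireg xb = b) (hsk : s.ireg xk = k)
    (h : IsArgmin (I.cost a) {j | j < m + l ∧ s.iarr aF j = 1 ∧ b * (n * n) ≤ j ∧
      j < b * (n * n) + k} (s.ireg xe)) :
    Runs S W blockMinStep s 1000 fun s' =>
      IsArgmin (I.cost a) {j | j < m + l ∧ s.iarr aF j = 1 ∧ b * (n * n) ≤ j ∧
        j < b * (n * n) + (k + 1)} (s'.ireg xe) := by
  have hle := numBlocks_mul_le (I := I) hE.lt
  have hbk : b * (n * n) + n * n ≤ n * n * I.numBlocks := by
    rw [← Nat.succ_mul, mul_comm (n * n)]; exact Nat.mul_le_mul_right _ hb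
  have hS := hE.S_ge
  have hW := hE.W_ge
  have hlt := hE.lt
  have he : s.ireg xe ≤ m + l := by
    by_cases h0 : s.ireg xe = 0
    · omega
    · have := (h.mem h0).1; omega
  have hset : ∀ P : Prop, (P ↔ (b * (n * n) + k < m + l ∧ s.iarr aF (b * (n * n) + k) = 1)) →
      {j | j < m + l ∧ s.iarr aF j = 1 ∧ b * (n * n) ≤ j ∧ j < b * (n * n) + (k + 1)} =
      {j | j < m + l ∧ s.iarr aF j = 1 ∧ b * (n * n) ≤ j ∧ j < b * (n * n) + k} ∪
        {j | j = b * (n * n) + k ∧ P} := by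
    intro P hP
    ext j
    simp only [Set.mem_union, Set.mem_ofPred_eq, hP]
    constructor
    · rintro ⟨h₁, h₂, h₃, h₄⟩
      by_cases hj : j = b * (n * n) + k
      · exact .inr ⟨hj, hj ▸ h₁, hj ▸ h₂⟩
      · exact .inl ⟨h₁, h₂, h₃, by omega⟩
    · rintro (⟨h₁, h₂, h₃, h₄⟩ | ⟨rfl, h₁, h₂⟩)
      · exact ⟨h₁, h₂, h₃, by omega⟩
      · exact ⟨h₁, h₂, by omega, by omega⟩
  have hsub : {j | j = b * (n * n) + k ∧ (b * (n * n) + k < m + l ∧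
      s.iarr aF (b * (n * n) + k) = 1)} ⊆ {b * (n * n) + k} := fun j hj => hj.1
  refine Runs.of_wp (by decide) ?_
  simp [blockMinStep, orTest, wp, IExp.Ok, IExp.eval, Test.Ok, Test.Holds, costExp_eval (I := I),
    hsa, hsb, hsk, hE.xn_eq, hE.xN_eq, hE.xK_eq, hE.arr0, hE.arr1, hE.arr2, hE.arr3, hE.arr4,
    hE.arr5]
  refine ⟨by omega, ⟨by omega, ?_, ?_⟩, fun h₁ h₂ h₃ => ⟨by omega, ?_⟩, fun h₁ => ?_⟩
  · exact costExp_ok (n := n) (by simp [hE.xn_eq]) hE.n_le (by simp [IExp.Ok])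
      (by simp [IExp.Ok]) (by simpa [IExp.eval, hsa]) (by simp [IExp.eval]; omega)
  · exact costExp_ok (n := n) (by simp [hE.xn_eq]) hE.n_le (by simp [IExp.Ok])
      (by simp [IExp.Ok]; omega) (by simpa [IExp.eval, hsa]) (by simp [IExp.eval]; omega)
  · rw [hset _ Iff.rfl]
    refine h.union_right (.inr ⟨_, rfl, ⟨rfl, h₁, h₂⟩, ?_⟩) (by simp) ?_
    · rintro j ⟨rfl, -⟩; exact le_rfl
    · by_cases h0 : s.ireg xe = 0
      exacts [.inl h0, .inr (by simpa using h₃ h0)]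
  · rw [hset _ Iff.rfl]
    by_cases hP : b * (n * n) + k < m + l ∧ s.iarr aF (b * (n * n) + k) = 1
    · refine h.union_left (e' := b * (n * n) + k + 1) (.inr ⟨_, rfl, ⟨rfl, hP⟩, ?_⟩) ?_
      · rintro j ⟨rfl, -⟩; exact le_rfl
      · have := h₁ hP.1 hP.2
        push Not
        exact fun _ => ⟨this.1, by simpa using this.2⟩
    · simpa [hP] using h

theorem blockMin_runs {S W : ℕ} {s : State} (hE : I.Env S W s) {t : ℕ}
    (ht : t < n * n * I.numBlocks) (hst : s.ireg xt = t) :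
    Runs S W blockMin s (1100 * (n * n) + 1100) fun s' =>
      ∃ e, s'.iarr aB = Function.update (s.iarr aB) t e ∧
        IsArgmin (I.cost (t / I.numBlocks)) (I.freeIn (s.iarr aF) (t % I.numBlocks)) e := by
  have hle := numBlocks_mul_le (I := I) hE.lt
  have hS := hE.S_ge
  have hW := hE.W_ge
  have hlt := hE.lt
  have hn : 0 < n := by
    rcases Nat.eq_zero_or_pos n with rfl | h
    · simp at ht
    · exact h
  have hnb : 0 < I.numBlocks := Nat.succ_pos _
  set a := t / I.numBlocks with hadef
  set b := t % I.numBlocks with hbdef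
  have ha : a < n * n := Nat.div_lt_of_lt_mul (by rwa [mul_comm])
  have hb : b < I.numBlocks := Nat.mod_lt _ hnb
  refine (Runs.seq_frame (T₁ := 20) (T₂ := (n * n) * 1008 + 6 + 10)
    (R := fun s' => s'.ireg xa = a ∧ s'.ireg xb = b ∧ s'.ireg xe = 0)
    (Runs.of_wp (by decide) ?_) ?_).mono (by omega) fun _ h => h
  · simp [wp, IExp.Ok, IExp.eval, hE.xB_eq hn, hst, hnb.ne', hadef, hbdef]
  rintro s₁ hF₁ ⟨h₁, h₂, h₃⟩
  have hE₁ := hE.of_frame hF₁ (by decide) (by decide)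
  refine Runs.seq_frame (Runs.forLoop (T := 1000) (B := n * n) (fun k s' =>
    IsArgmin (I.cost a) {j | j < m + l ∧ s.iarr aF j = 1 ∧ b * (n * n) ≤ j ∧
      j < b * (n * n) + k} (s'.ireg xe)) hE₁.xK_eq (by omega) (by decide) (by decide) (by decide)
    ?_ ?_) ?_
  · refine .inl ⟨by simpa using h₃, Set.eq_empty_of_forall_notMem ?_⟩
    rintro j ⟨-, -, h, h'⟩
    omega
  · intro k s₂ hk hF₂ hsk h
    have e : s₂.iarr aF = s.iarr aF :=
      (hF₂.iarr aF (by decide)).trans (hF₁.iarr aF (by decide))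
    have := blockMinStep_runs (hE₁.of_frame hF₂ (by decide) (by decide)) ha hb hk
      ((hF₂.ireg xa (by decide)).trans h₁) ((hF₂.ireg xb (by decide)).trans h₂) hsk (by rwa [e])
    refine this.mono le_rfl fun s₃ h => ?_
    rw [e] at h
    simpa using h
  · intro s₂ hF₂ h
    have e₁ : s₂.iarr aB = s.iarr aB :=
      (hF₂.iarr aB (by decide)).trans (hF₁.iarr aB (by decide))
    have e₂ : s₂.ireg xt = t :=
      ((hF₂.ireg xt (by decide)).trans (hF₁.ireg xt (by decide))).trans hst
    refine Runs.of_wp (by decide) ?_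
    refine ⟨⟨trivial, ?_, trivial⟩, s₂.ireg xe, ?_, ?_⟩
    · simp only [IExp.eval, e₂]; omega
    · simp [IExp.eval, e₁, e₂]
    · -- the block `b` consists of the columns from `b * n²` to `b * n² + n² - 1`
      convert h using 1
      ext j
      simp only [freeIn, Set.mem_ofPred_eq, Nat.div_eq_iff (show 0 < n * n by positivity)]
      have : 0 < n * n := by positivity
      constructor
      · rintro ⟨h₁, h₂, h₃⟩; exact ⟨h₁, h₂, by omega, by omega⟩
      · rintro ⟨h₁, h₂, h₃, h₄⟩; exact ⟨h₁, h₂, by omega, by omega⟩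

/-- One step of the search for a best free column for the row `xr`. -/
def rowMinStep : Prog :=
  .seq (.iset xj (.get aB (.add (.mul (.reg xr) (.reg xB)) (.reg xk))))
    (.cond (.and (.not (.ieq (.reg xj) (.const 0)))
        (orTest (.ieq (.reg xe) (.const 0))
          (.rlt (costExp (.reg xr) (.sub (.reg xj) (.const 1)))
            (costExp (.reg xr) (.sub (.reg xe) (.const 1))))))
      (.iset xe (.reg xj)) .skip)

/-- Computes a best free column for the row `xr` from the table. -/
def rowMin : Prog :=
  .seq (.iset xe (.const 0)) (forLoop xk xB rowMinStep)

theorem rowMin_runs {S W : ℕ} {s : State} (hE : I.Env S W s) {r : ℕ}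
    (hr : r < n * n) (hsr : s.ireg xr = r) (hT : I.IsTable (s.iarr aF) (s.iarr aB)) :
    Runs S W rowMin s (1100 * I.numBlocks + 1100) fun s' =>
      IsArgmin (I.cost r) {j | j < m + l ∧ s.iarr aF j = 1} (s'.ireg xe) := by
  have hle := numBlocks_mul_le (I := I) hE.lt
  have hS := hE.S_ge
  have hW := hE.W_ge
  have hlt := hE.lt
  have hn : 0 < n := by
    rcases Nat.eq_zero_or_pos n with rfl | h
    · simp at hr
    · exact h
  have hnb : 0 < I.numBlocks := Nat.succ_pos _
  have hnb' : I.numBlocks ≤ n * n * I.numBlocks := Nat.le_mul_of_pos_left _ (by positivity)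
  refine (Runs.seq_frame (T₁ := 2) (T₂ := I.numBlocks * 1008 + 6)
    (R := fun s' => s'.ireg xe = 0) (Runs.of_wp (by decide) ?_) ?_).mono (by omega) fun _ h => h
  · simp [wp, IExp.Ok, IExp.eval]
  intro s₁ hF₁ h₁
  have hE₁ := hE.of_frame hF₁ (by decide) (by decide)
  refine (Runs.forLoop (T := 1000) (B := I.numBlocks) (fun k s' =>
    IsArgmin (I.cost r) {j | j < m + l ∧ s.iarr aF j = 1 ∧ j / (n * n) < k} (s'.ireg xe))
    (hE₁.xB_eq hn) (by omega) (by decide) (by decide) (by decide) ?_ ?_).mono le_rfl ?_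
  · exact .inl ⟨by simpa using h₁, Set.eq_empty_of_forall_notMem fun j hj => by simpa using hj.2.2⟩
  · intro k s₂ hk hF₂ hsk h
    have hE₂ := hE₁.of_frame hF₂ (by decide) (by decide)
    have e₁ : s₂.iarr aB = s.iarr aB :=
      (hF₂.iarr aB (by decide)).trans (hF₁.iarr aB (by decide))
    have e₂ : s₂.ireg xr = r :=
      ((hF₂.ireg xr (by decide)).trans (hF₁.ireg xr (by decide))).trans hsr
    have htlt : r * I.numBlocks + k < n * n * I.numBlocks :=
      lt_of_lt_of_le (by rw [Nat.succ_mul]; omega) (Nat.mul_le_mul_right _ hr)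
    have hcell := hT _ htlt
    have hd : (r * I.numBlocks + k) / I.numBlocks = r := by
      rw [mul_comm, Nat.mul_add_div hnb, Nat.div_eq_of_lt hk, add_zero]
    have hm : (r * I.numBlocks + k) % I.numBlocks = k := by
      rw [mul_comm, Nat.mul_add_mod, Nat.mod_eq_of_lt hk]
    rw [hd, hm] at hcell
    have hset : {j | j < m + l ∧ s.iarr aF j = 1 ∧ j / (n * n) ≤ k} =
        {j | j < m + l ∧ s.iarr aF j = 1 ∧ j / (n * n) < k} ∪ I.freeIn (s.iarr aF) k := by
      ext j
      simp only [freeIn, Set.mem_union, Set.mem_ofPred_eq, le_iff_lt_or_eq]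
      tauto
    have he : s₂.ireg xe ≤ m + l := by
      by_cases h0 : s₂.ireg xe = 0
      · omega
      · have := (h.mem h0).1; omega
    have he' : s.iarr aB (r * I.numBlocks + k) ≤ m + l := by
      by_cases h0 : s.iarr aB (r * I.numBlocks + k) = 0
      · omega
      · have := (hcell.mem h0).1; omega
    refine Runs.of_wp (by decide) ?_
    simp [rowMinStep, orTest, wp, IExp.Ok, IExp.eval, Test.Ok, Test.Holds, costExp_eval (I := I),
      e₁, e₂, hsk, hE₂.xn_eq, hE₂.xB_eq hn, hE₂.arr0, hE₂.arr1, hE₂.arr2,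
      hE₂.arr3, hE₂.arr4, hE₂.arr5]
    refine ⟨by omega, ⟨?_, ?_⟩, fun h₁ h₂ => ?_, fun h₁ => ?_⟩
    · exact costExp_ok (n := n) (by simp [hE₂.xn_eq]) hE.n_le (by simp [IExp.Ok])
        (by simp [IExp.Ok]; omega) (by simpa [IExp.eval, e₂]) (by simp [IExp.eval]; omega)
    · exact costExp_ok (n := n) (by simp [hE₂.xn_eq]) hE.n_le (by simp [IExp.Ok])
        (by simp [IExp.Ok]; omega) (by simpa [IExp.eval, e₂]) (by simp [IExp.eval]; omega)
    · rw [hset]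
      refine h.union_right hcell h₁ ?_
      by_cases h0 : s₂.ireg xe = 0
      exacts [.inl h0, .inr (h₂ h0)]
    · rw [hset]
      refine h.union_left hcell ?_
      push Not
      exact h₁
  · intro s₂ h
    convert h using 1
    ext j
    simp only [Set.mem_ofPred_eq]
    refine ⟨fun h => ⟨h.1, h.2, Nat.lt_succ_of_le (Nat.div_le_div_right h.1.le)⟩,
      fun h => ⟨h.1, h.2.1⟩⟩

/-! ### The search for an augmenting path -/

/-- Updates the least slack `yM` of the edges from the tree to the free columns, and the edge
`(xg, xf)` where it is attained, when the row `xr` is scanned whose best free column is `xe - 1`. The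
scan of the root `xi` overwrites the values of the previous phase. -/
def scanFree : Prog :=
  .cond (orTest (.ieq (.reg xr) (.reg xi))
      (.rlt (.sub (costExp (.reg xr) (.sub (.reg xe) (.const 1))) (.get bU (.reg xr))) (.reg yM)))
    (.seq (.rset yM (.sub (costExp (.reg xr) (.sub (.reg xe) (.const 1))) (.get bU (.reg xr))))
      (.seq (.iset xf (.sub (.reg xe) (.const 1))) (.iset xg (.reg xr)))) .skip

theorem scanFree_runs {S W : ℕ} {s : State} (hE : I.Env S W s) {i r e : ℕ} (hr : r < n * n)
    (hsr : s.ireg xr = r) (hsi : s.ireg xi = i) (hse : s.ireg xe = e + 1) (he : e < m + l) :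
    Runs S W scanFree s 1000 fun s' =>
      ((r = i ∨ I.cost r e - s.rarr bU r < s.rreg yM) ∧
        s'.rreg yM = I.cost r e - s.rarr bU r ∧ s'.ireg xf = e ∧ s'.ireg xg = r) ∨
      ((r ≠ i ∧ s.rreg yM ≤ I.cost r e - s.rarr bU r) ∧
        s'.rreg yM = s.rreg yM ∧ s'.ireg xf = s.ireg xf ∧ s'.ireg xg = s.ireg xg) := by
  have hS := hE.S_ge
  have hW := hE.W_ge
  have hlt := hE.lt
  have hc : (costExp (.reg xr) (.sub (.reg xe) (.const 1))).Ok S W s :=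
    costExp_ok (n := n) (by simp [hE.xn_eq]) hE.n_le (by simp [IExp.Ok])
      (by simp [IExp.Ok]; omega) (by simpa [IExp.eval, hsr]) (by simp [IExp.eval]; omega)
  refine Runs.of_wp (by decide) ?_
  simp [scanFree, orTest, wp, RExp.Ok, RExp.eval, IExp.Ok, IExp.eval, Test.Ok, Test.Holds,
    costExp_eval (I := I), hsr, hsi, hse, hE.xn_eq, hE.arr0, hE.arr1, hE.arr2, hE.arr3, hE.arr4,
    hE.arr5, hc]
  refine ⟨by omega, fun h => ⟨by omega, by omega, .inl ?_⟩, fun h₁ h₂ => .inr ⟨h₁, h₂⟩⟩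
  exact or_iff_not_imp_left.2 h

/-- The slack of the edge between the row `xr` and the column that is matched to the row `xa`. -/
def slackExp : RExp :=
  .sub (.sub (costExp (.reg xr) (.get aM (.reg xa))) (.get bU (.reg xr)))
    (.sub (costExp (.reg xa) (.get aM (.reg xa))) (.get bU (.reg xa)))

/-- Updates the least slack of the column that is matched to the row `xa`, when the row `xr` is
scanned. The scan of the root `xi` overwrites the values of the previous phase. -/
def scanStep : Prog :=
  .cond (.ieq (.get aT (.reg xa)) (.reg xp)) .skip
    (.seq (.rset yX slackExp)
      (.cond (orTest (.ieq (.reg xr) (.reg xi)) (.rlt (.reg yX) (.get bD (.reg xa))))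
        (.seq (.rput bD (.reg xa) (.reg yX)) (.iput aW (.reg xa) (.reg xr))) .skip))

open Classical in
theorem scanStep_runs {S W : ℕ} {s : State} (hE : I.Env S W s) {i r a : ℕ} (hr : r < n * n)
    (ha : a < n * n) (hsr : s.ireg xr = r) (hsi : s.ireg xi = i) (hsa : s.ireg xa = a)
    (hsp : s.ireg xp = i + 1) (hM : s.iarr aM a < m + l) {x : ℝ}
    (hx : x = I.cost r (s.iarr aM a) - s.rarr bU r - (I.cost a (s.iarr aM a) - s.rarr bU a)) :
    Runs S W scanStep s 1000 fun s' =>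
      s'.rarr bD = (if s.iarr aT a ≠ i + 1 ∧ (r = i ∨ x < s.rarr bD a) then
        Function.update (s.rarr bD) a x else s.rarr bD) ∧
      s'.iarr aW = (if s.iarr aT a ≠ i + 1 ∧ (r = i ∨ x < s.rarr bD a) then
        Function.update (s.iarr aW) a r else s.iarr aW) := by
  have hS := hE.S_ge
  have hW := hE.W_ge
  have hlt := hE.lt
  have hc : ∀ y, y = xr ∨ y = xa → (costExp (.reg y) (.get aM (.reg xa))).Ok S W s := by
    intro y hy
    refine costExp_ok (n := n) (by simp [hE.xn_eq]) hE.n_le (by simp [IExp.Ok])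
      (by simp [IExp.Ok, hsa, IExp.eval]; omega) ?_ (by simp [IExp.eval, hsa]; omega)
    rcases hy with rfl | rfl <;> simpa [IExp.eval, hsr, hsa]
  refine Runs.of_wp (by decide) ?_
  have e₁ : slackExp.eval s = x := by
    simp [slackExp, RExp.eval, costExp_eval (I := I), IExp.eval, hsr, hsa, hE.xn_eq, hE.arr0,
      hE.arr1, hE.arr2, hE.arr3, hE.arr4, hE.arr5, hx]
  have e₂ : slackExp.Ok S W s := by
    have h₁ : s.ireg xr < S := by omega
    have h₂ : s.ireg xa < S := by omega
    exact ⟨⟨hc _ (.inl rfl), trivial, h₁⟩, hc _ (.inr rfl), trivial, h₂⟩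
  simp [scanStep, orTest, wp, e₁, e₂, RExp.Ok, RExp.eval, IExp.Ok, IExp.eval, Test.Ok, Test.Holds,
    hsr, hsi, hsa, hsp]
  refine ⟨by omega, fun h => by simp [h], fun h => ⟨by omega, fun h' => ?_, fun h₁ h₂ => ?_⟩⟩
  · have h'' := or_iff_not_imp_left.2 h'
    simp only [h, not_false_eq_true]
    exact ⟨by omega, fun hh => absurd (h' (hh trivial).1) (hh trivial).2.not_gt,
      fun hh => absurd (h' (hh trivial).1) (hh trivial).2.not_gt⟩
  · simp [h, h₁, not_lt.2 h₂]

/-- Updates the least slacks of the columns outside the tree when the row `xr` is scanned. -/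
def scan : Prog := forLoop xa xi scanStep

open Classical in
theorem scan_runs {S W : ℕ} {s : State} (hE : I.Env S W s) {i r : ℕ} (hr : r < n * n)
    (hi : i ≤ n * n) (hsr : s.ireg xr = r) (hsi : s.ireg xi = i) (hsp : s.ireg xp = i + 1)
    (hM : ∀ a < i, s.iarr aM a < m + l) {x : ℕ → ℝ} (hx : ∀ a, x a =
      I.cost r (s.iarr aM a) - s.rarr bU r - (I.cost a (s.iarr aM a) - s.rarr bU a)) :
    Runs S W scan s (1100 * (n * n) + 1100) fun s' =>
      s'.rarr bD = (fun a => if a < i ∧ s.iarr aT a ≠ i + 1 ∧ (r = i ∨ x a < s.rarr bD a) then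
        x a else s.rarr bD a) ∧
      s'.iarr aW = (fun a => if a < i ∧ s.iarr aT a ≠ i + 1 ∧ (r = i ∨ x a < s.rarr bD a) then
        r else s.iarr aW a) := by
  have hW := hE.W_ge
  have hlt := hE.lt
  refine (Runs.forLoop (T := 1000) (B := i) (fun k s' =>
    s'.rarr bD = (fun a => if a < k ∧ s.iarr aT a ≠ i + 1 ∧ (r = i ∨ x a < s.rarr bD a) then
        x a else s.rarr bD a) ∧
      s'.iarr aW = (fun a => if a < k ∧ s.iarr aT a ≠ i + 1 ∧ (r = i ∨ x a < s.rarr bD a) then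
        r else s.iarr aW a)) hsi (by omega) (by decide) (by decide) (by decide) ?_ ?_).mono ?_
        fun _ h => h
  · simp
  · rintro k s₂ hk hF hsk ⟨h₁, h₂⟩
    have e₁ : s₂.iarr aM = s.iarr aM := hF.iarr aM (by decide)
    have e₂ : s₂.iarr aT = s.iarr aT := hF.iarr aT (by decide)
    have e₃ : s₂.rarr bU = s.rarr bU := hF.rarr bU (by decide)
    refine (scanStep_runs (hE.of_frame hF (by decide) (by decide)) (a := k) hr (by omega)
      ((hF.ireg xr (by decide)).trans hsr) ((hF.ireg xi (by decide)).trans hsi) hsk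
      ((hF.ireg xp (by decide)).trans hsp) (by rw [e₁]; exact hM k hk)
      (x := x k) (by rw [e₁, e₃, hx])).mono le_rfl ?_
    rintro s₃ ⟨h₃, h₄⟩
    have hD : s₂.rarr bD k = s.rarr bD k := by simp [h₁]
    rw [e₂, hD] at h₃ h₄
    simp only [h₃, h₄]
    constructor
    · funext a
      rcases lt_trichotomy a k with h | rfl | h
      · simp [h₁, h.ne, h, Nat.lt_succ_of_lt h, apply_ite (fun f : ℕ → ℝ => f a)]
      · simp [h₁, apply_ite (fun f : ℕ → ℝ => f a)]
      · simp [h₁, h.ne', h.not_gt, show ¬ a < k + 1 by omega, apply_ite (fun f : ℕ → ℝ => f a)]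
    · funext a
      rcases lt_trichotomy a k with h | rfl | h
      · simp [h₂, h.ne, h, Nat.lt_succ_of_lt h, apply_ite (fun f : ℕ → ℕ => f a)]
      · simp [h₂, apply_ite (fun f : ℕ → ℕ => f a)]
      · simp [h₂, h.ne', h.not_gt, show ¬ a < k + 1 by omega, apply_ite (fun f : ℕ → ℕ => f a)]
  · linarith

/-- One step of the search for a row outside the tree whose column has the least slack. -/
def pickStep : Prog :=
  .cond (.and (.not (.ieq (.get aT (.reg xa)) (.reg xp)))
      (orTest (.ieq (.reg xs) (.const 0))
        (.rlt (.get bD (.reg xa)) (.get bD (.sub (.reg xs) (.const 1))))))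
    (.iset xs (.add (.reg xa) (.const 1))) .skip

/-- Searches a row outside the tree whose column has the least slack. -/
def pick : Prog := .seq (.iset xs (.const 0)) (forLoop xa xi pickStep)

theorem pick_runs {S W : ℕ} {s : State} (hE : I.Env S W s) {i : ℕ}
    (hi : i ≤ n * n) (hsi : s.ireg xi = i) (hsp : s.ireg xp = i + 1) :
    Runs S W pick s (1100 * (n * n) + 1100) fun s' =>
      IsArgmin (s.rarr bD) {a | a < i ∧ s.iarr aT a ≠ i + 1} (s'.ireg xs) := by
  have hS := hE.S_ge
  have hW := hE.W_ge
  have hlt := hE.lt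
  refine (Runs.seq_frame (T₁ := 2) (T₂ := i * 1008 + 6)
    (R := fun s' => s'.ireg xs = 0) (Runs.of_wp (by decide) ?_) ?_).mono ?_ fun _ h => h
  · simp [wp, IExp.Ok, IExp.eval]
  swap
  · linarith
  intro s₁ hF₁ h₁
  refine Runs.forLoop (T := 1000) (B := i) (fun k s' =>
    IsArgmin (s.rarr bD) {a | a < k ∧ s.iarr aT a ≠ i + 1} (s'.ireg xs))
    ((hF₁.ireg xi (by decide)).trans hsi) (by omega) (by decide) (by decide) (by decide) ?_ ?_
  · exact .inl ⟨by simpa using h₁, Set.eq_empty_of_forall_notMem fun j hj => by simpa using hj.1⟩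
  · intro k s₂ hk hF₂ hsk h
    have e₁ : s₂.iarr aT = s.iarr aT :=
      (hF₂.iarr aT (by decide)).trans (hF₁.iarr aT (by decide))
    have e₂ : s₂.rarr bD = s.rarr bD :=
      (hF₂.rarr bD (by decide)).trans (hF₁.rarr bD (by decide))
    have e₃ : s₂.ireg xp = i + 1 :=
      ((hF₂.ireg xp (by decide)).trans (hF₁.ireg xp (by decide))).trans hsp
    have hset : {a | a ≤ k ∧ s.iarr aT a ≠ i + 1} =
        {a | a < k ∧ s.iarr aT a ≠ i + 1} ∪ {a | a = k ∧ s.iarr aT k ≠ i + 1} := by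
      ext a
      simp only [Set.mem_union, Set.mem_ofPred_eq, le_iff_lt_or_eq]
      constructor
      · rintro ⟨h | rfl, h'⟩
        exacts [.inl ⟨h, h'⟩, .inr ⟨rfl, h'⟩]
      · rintro (⟨h, h'⟩ | ⟨rfl, h'⟩)
        exacts [⟨.inl h, h'⟩, ⟨.inr rfl, h'⟩]
    have he : s₂.ireg xs ≤ m + l := by
      by_cases h0 : s₂.ireg xs = 0
      · omega
      · have := (h.mem h0).1; omega
    refine Runs.of_wp (by decide) ?_
    simp [pickStep, orTest, wp, RExp.Ok, RExp.eval, IExp.Ok, IExp.eval, Test.Ok, Test.Holds,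
      e₁, e₂, e₃, hsk]
    simp only [ne_eq] at hset h
    refine ⟨by omega, fun h₁ h₂ => ⟨by omega, ?_⟩, fun h₁ => ?_⟩
    · rw [hset]
      refine h.union_right (.inr ⟨_, rfl, ⟨rfl, h₁⟩, ?_⟩) (by simp) ?_
      · rintro j ⟨rfl, -⟩; exact le_rfl
      · by_cases h0 : s₂.ireg xs = 0
        exacts [.inl h0, .inr (by simpa using h₂ h0)]
    · rw [hset]
      by_cases hP : s.iarr aT k = i + 1
      · simpa [hP] using h
      · refine h.union_left (e' := k + 1) (.inr ⟨_, rfl, ⟨rfl, hP⟩, ?_⟩) ?_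
        · rintro j ⟨rfl, -⟩; exact le_rfl
        · push Not
          exact fun _ => by simpa using h₁ hP

/-- Computes the least slack `yD` of the edges that leave the tree, and decides whether an edge to a
free column attains it. -/
def choose : Prog :=
  .cond (.and (.not (.ieq (.reg xs) (.const 0)))
      (.rlt (.get bD (.sub (.reg xs) (.const 1))) (.reg yM)))
    (.rset yD (.get bD (.sub (.reg xs) (.const 1))))
    (.seq (.rset yD (.reg yM)) (.iset xd (.const 1)))

theorem choose_runs {S W : ℕ} {s : State} (hE : I.Env S W s) {P : Set ℕ}
    (hP : ∀ a ∈ P, a < n * n) (h : IsArgmin (s.rarr bD) P (s.ireg xs)) (hd : s.ireg xd = 0) :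
    Runs S W choose s 1000 fun s' =>
      (∀ a ∈ P, s'.rreg yD ≤ s.rarr bD a) ∧ s'.rreg yD ≤ s.rreg yM ∧
      ((s'.ireg xd = 0 ∧ s.ireg xs ≠ 0 ∧ s.ireg xs - 1 ∈ P ∧
        s'.rreg yD = s.rarr bD (s.ireg xs - 1)) ∨ (s'.ireg xd = 1 ∧ s'.rreg yD = s.rreg yM)) := by
  have hS := hE.S_ge
  have hW := hE.W_ge
  have hlt := hE.lt
  have he : s.ireg xs ≤ m + l := by
    by_cases h0 : s.ireg xs = 0
    · omega
    · have := hP _ (h.mem h0); omega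
  refine Runs.of_wp (by decide) ?_
  simp [choose, wp, RExp.Ok, RExp.eval, IExp.Ok, IExp.eval, Test.Ok, Test.Holds, hd]
  refine ⟨by omega, fun h₁ h₂ => ⟨by omega, fun a ha => h.le ha, h₂.le, ⟨h₁, h.mem h₁⟩⟩,
    fun h₁ => ⟨by omega, fun a ha => ?_⟩⟩
  exact (h₁ (h.ne_zero ⟨a, ha⟩)).trans (h.le ha)

/-- Shifts the potential of the row `xa` or the least slack of its column by `yD`. -/
def shiftStep : Prog :=
  .cond (.ieq (.get aT (.reg xa)) (.reg xp))
    (.rput bU (.reg xa) (.add (.get bU (.reg xa)) (.reg yD)))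
    (.rput bD (.reg xa) (.sub (.get bD (.reg xa)) (.reg yD)))

/-- Shifts the potentials of the tree rows and the least slacks of the columns of the other rows by
`yD`. -/
def shift : Prog := forLoop xa xp shiftStep

theorem shift_runs {S W : ℕ} {s : State} (hE : I.Env S W s) {i : ℕ}
    (hi : i < n * n) (hsp : s.ireg xp = i + 1) :
    Runs S W shift s (1100 * (n * n) + 1100) fun s' =>
      (s'.rarr bU = fun a => if a < i + 1 ∧ s.iarr aT a = i + 1 then s.rarr bU a + s.rreg yD
        else s.rarr bU a) ∧
      (s'.rarr bD = fun a => if a < i + 1 ∧ s.iarr aT a ≠ i + 1 then s.rarr bD a - s.rreg yD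
        else s.rarr bD a) := by
  have hS := hE.S_ge
  have hW := hE.W_ge
  have hlt := hE.lt
  refine (Runs.forLoop (T := 1000) (B := i + 1) (fun k s' =>
    (s'.rarr bU = fun a => if a < k ∧ s.iarr aT a = i + 1 then s.rarr bU a + s.rreg yD
        else s.rarr bU a) ∧
      (s'.rarr bD = fun a => if a < k ∧ s.iarr aT a ≠ i + 1 then s.rarr bD a - s.rreg yD
        else s.rarr bD a)) hsp (by omega) (by decide) (by decide) (by decide) ?_ ?_).mono ?_
        fun _ h => h
  · simp
  · rintro k s₂ hk hF hsk ⟨h₁, h₂⟩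
    have e₁ : s₂.iarr aT = s.iarr aT := hF.iarr aT (by decide)
    have e₂ : s₂.rreg yD = s.rreg yD := hF.rreg yD (by decide)
    have e₃ : s₂.ireg xp = i + 1 := (hF.ireg xp (by decide)).trans hsp
    refine Runs.of_wp (by decide) ?_
    simp [shiftStep, wp, RExp.Ok, RExp.eval, IExp.Ok, IExp.eval, Test.Ok, Test.Holds, e₁, e₂, e₃,
      hsk, h₁, h₂]
    refine ⟨by omega, fun h => ⟨by omega, ?_, ?_⟩, fun h => ⟨by omega, ?_, ?_⟩⟩ <;> funext a <;>
      grind [Function.update_apply]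
  · linarith

/-- The state `s'` agrees with `s` in what stays unchanged from the start of an iteration of the
search until the potentials are shifted. -/
structure SameCore (I : Data n m l) (S W : ℕ) (s s' : State) : Prop where
  env : I.Env S W s'
  xi_eq : s'.ireg xi = s.ireg xi
  xp_eq : s'.ireg xp = s.ireg xp
  xr_eq : s'.ireg xr = s.ireg xr
  aF_eq : s'.iarr aF = s.iarr aF
  aM_eq : s'.iarr aM = s.iarr aM
  aT_eq : s'.iarr aT = s.iarr aT
  aB_eq : s'.iarr aB = s.iarr aB
  bU_eq : s'.rarr bU = s.rarr bU

theorem SameCore.of_frame {S W : ℕ} {p : Prog} {s s' s'' : State} (h : I.SameCore S W s s')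
    (hF : p.Frame s' s'') (h₁ : ∀ x ∈ [0, 3, 4, 5, 19, 6, 7, 18], x ∉ p.iregs)
    (h₂ : ∀ a ∈ [0, 1, 2, 3, 4, 5, 6], a ∉ p.rarrs) (h₃ : ∀ a ∈ [0, 1, 2, 4], a ∉ p.iarrs) :
    I.SameCore S W s s'' :=
  ⟨h.env.of_frame hF (fun x hx => h₁ x (by simp at hx ⊢; tauto))
      (fun x hx => h₂ x (by simp at hx ⊢; tauto)),
    (hF.ireg _ (h₁ _ (by simp))).trans h.xi_eq, (hF.ireg _ (h₁ _ (by simp))).trans h.xp_eq,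
    (hF.ireg _ (h₁ _ (by simp))).trans h.xr_eq, (hF.iarr _ (h₃ _ (by simp))).trans h.aF_eq,
    (hF.iarr _ (h₃ _ (by simp))).trans h.aM_eq, (hF.iarr _ (h₃ _ (by simp))).trans h.aT_eq,
    (hF.iarr _ (h₃ _ (by simp))).trans h.aB_eq, (hF.rarr _ (h₂ _ (by simp))).trans h.bU_eq⟩

/-- Completes the shift of the potentials, and adds the row `xs - 1` to the tree unless the search is
over. -/
def grow : Prog :=
  .seq (.rset yM (.sub (.reg yM) (.reg yD)))
    (.cond (.ieq (.reg xd) (.const 0))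
      (.seq (.iset xr (.sub (.reg xs) (.const 1))) (.iput aT (.reg xr) (.reg xp))) .skip)

/-- One iteration of the search for an augmenting path: the row `xr`, which was added to the tree
last, is scanned, the potentials are shifted, and a row is added to the tree or a free column is
reached. -/
def searchStep : Prog :=
  .seq rowMin (.seq scanFree (.seq scan (.seq pick (.seq choose (.seq shift grow)))))

/-- The tree in the memory, with potentials `v` of the columns and the order `ρ` of the rows. -/
structure TreeState (I : Data n m l) (i : ℕ) (v : ℕ → ℝ) (ρ : ℕ → ℕ) (s : State) : Prop where
  dual : I.Dual i (s.iarr aM) (s.iarr aF) (s.rarr bU) v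
  tree : I.Tree i (s.iarr aM) (s.iarr aT) (s.iarr aW) ρ (s.rarr bU) v
  stamp : ∀ a, s.iarr aT a ≤ i + 1
  rank : ∀ a, s.iarr aT a = i + 1 → ρ a ≤ i

/-- The search goes on with the row `xr`; the tree has `k + 1` rows, and all of them except `xr` have
been scanned. -/
structure Active (I : Data n m l) (i k : ℕ) (v : ℕ → ℝ) (ρ : ℕ → ℕ) (s : State) : Prop where
  not_done : s.ireg xd = 0
  mem : s.iarr aT (s.ireg xr) = i + 1
  root : s.ireg xr = i → ∀ b, s.iarr aT b = i + 1 → b = i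
  rank : ∀ a, s.iarr aT a = i + 1 → ρ a ≤ k
  card : ((Finset.range (i + 1)).filter fun a => s.iarr aT a = i + 1).card = k + 1
  scanned : I.Scanned i {b | s.iarr aT b = i + 1 ∧ b ≠ s.ireg xr} (s.iarr aM) (s.iarr aF)
    (s.iarr aT) (s.iarr aW) (s.rarr bU) v (s.rarr bD) (s.rreg yM) (s.ireg xf) (s.ireg xg)

/-- The search has reached the free column `xf` by a tight edge from the tree row `xg`. -/
structure Finished (I : Data n m l) (i : ℕ) (s : State) : Prop where
  done : s.ireg xd = 1
  mem : s.iarr aT (s.ireg xg) = i + 1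
  lt : s.ireg xf < m + l
  free : s.iarr aF (s.ireg xf) = 1
  tight : I.cost (s.ireg xg) (s.ireg xf) - s.rarr bU (s.ireg xg) = 0

/-- The invariant of the search. -/
def SearchInv (I : Data n m l) (i k : ℕ) (s : State) : Prop :=
  ∃ v ρ, I.TreeState i v ρ s ∧ (I.Active i k v ρ s ∨ I.Finished i s)

theorem Matching.exists_free (hM : I.Matching i M free) (hi : i < m + l) :
    ∃ j < m + l, free j = 1 := by
  classical
  by_contra! hno
  have hsub : Finset.range (m + l) ⊆ (Finset.range i).image M := fun j hj => by
    have hj := Finset.mem_range.1 hj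
    have := mt (hM.free_iff j hj).2 (hno j hj)
    push Not at this
    obtain ⟨a, ha, haj⟩ := this
    exact Finset.mem_image.2 ⟨a, Finset.mem_range.2 ha, haj⟩
  have := (Finset.card_le_card hsub).trans Finset.card_image_le
  simp at this
  omega

theorem searchStep_runs {S W : ℕ} {s : State} (hE : I.Env S W s) {i k : ℕ} (hi : i < n * n)
    (hsi : s.ireg xi = i) (hsp : s.ireg xp = i + 1) (hM : I.Matching i (s.iarr aM) (s.iarr aF))
    (hT : I.IsTable (s.iarr aF) (s.iarr aB)) {v : ℕ → ℝ} {ρ : ℕ → ℕ} (hs : I.TreeState i v ρ s)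
    (ha : I.Active i k v ρ s) :
    Runs S W searchStep s (1100 * I.numBlocks + 3300 * (n * n) + 10000) (I.SearchInv i (k + 1)) := by
  classical
  have hS := hE.S_ge
  have hW := hE.W_ge
  have hlt := hE.lt
  obtain ⟨j₀, hj₀, hfj₀⟩ := hM.exists_free (by omega)
  have hrle : s.ireg xr ≤ i := hs.tree.le _ ha.mem
  have hC₀ : I.SameCore S W s s := ⟨hE, rfl, rfl, rfl, rfl, rfl, rfl, rfl, rfl⟩
  refine (Runs.seq_frame (T₂ := 3300 * (n * n) + 8000) (rowMin_runs hE (by omega) rfl hT)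
    fun s₁ hF₁ h₁ => ?_).mono (by omega) fun _ h => h
  have he := h₁.mem (h₁.ne_zero ⟨j₀, hj₀, hfj₀⟩)
  have hC₁ := hC₀.of_frame hF₁ (by decide) (by decide) (by decide)
  refine (Runs.seq_frame (T₂ := 3 * (1100 * (n * n) + 1100) + 1100)
    (scanFree_runs hC₁.env (i := i) (r := s.ireg xr) (e := s₁.ireg xe - 1) (by omega) hC₁.xr_eq
      (hC₁.xi_eq.trans hsi) (by have := h₁.ne_zero ⟨j₀, hj₀, hfj₀⟩; omega) he.1)
    fun s₂ hF₂ h₂ => ?_).mono (by omega) fun _ h => h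
  have hC₂ := hC₁.of_frame hF₂ (by decide) (by decide) (by decide)
  refine (Runs.seq_frame (scan_runs (x := fun a => I.cost (s.ireg xr) (s.iarr aM a)
    - s.rarr bU (s.ireg xr) - (I.cost a (s.iarr aM a) - s.rarr bU a)) hC₂.env (by omega) hi.le
    hC₂.xr_eq (hC₂.xi_eq.trans hsi)
    (hC₂.xp_eq.trans hsp) (by rw [hC₂.aM_eq]; exact hM.lt) (by simp [hC₂.aM_eq, hC₂.bU_eq]))
    fun s₃ hF₃ h₃ => Runs.seq_frame (T₂ := 1100 * (n * n) + 1100 + 1100)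
      (pick_runs (hC₂.env.of_frame hF₃ (by decide) (by decide))
      hi.le ((hF₃.ireg _ (by decide)).trans (hC₂.xi_eq.trans hsi))
      ((hF₃.ireg _ (by decide)).trans (hC₂.xp_eq.trans hsp))) fun s₄ hF₄ h₄ => ?_).mono
    (by omega) fun _ h => h
  have hC₃ := hC₂.of_frame hF₃ (by decide) (by decide) (by decide)
  have hC₄ := hC₃.of_frame hF₄ (by decide) (by decide) (by decide)
  have eD : s₂.rarr bD = s.rarr bD :=
    (hF₂.rarr _ (by decide)).trans (hF₁.rarr _ (by decide))
  have eW : s₂.iarr aW = s.iarr aW :=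
    (hF₂.iarr _ (by decide)).trans (hF₁.iarr _ (by decide))
  have eM : s₁.rreg yM = s.rreg yM := hF₁.rreg _ (by decide)
  have ef : s₁.ireg xf = s.ireg xf := hF₁.ireg _ (by decide)
  have eg : s₁.ireg xg = s.ireg xg := hF₁.ireg _ (by decide)
  rw [hC₂.aT_eq, eD, eW] at h₃
  rw [hC₁.bU_eq, eM, ef, eg] at h₂
  -- now all rows of the tree are scanned
  obtain ⟨hsc, htr⟩ := ha.scanned.scan hs.dual hs.tree ha.mem ha.root he.1 he.2
    (fun j hj hfj => h₁.le ⟨hj, hfj⟩) (fun _ => rfl) h₃.1 h₃.2 h₂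
  have hne : {b | s.iarr aT b = i + 1}.Nonempty := ⟨i, hs.tree.root⟩
  rw [hC₃.aT_eq] at h₄
  have eD₄ : s₄.rarr bD = s₃.rarr bD := hF₄.rarr _ (by decide)
  have hd₄ : s₄.ireg xd = 0 := by
    rw [hF₄.ireg _ (by decide), hF₃.ireg _ (by decide), hF₂.ireg _ (by decide),
      hF₁.ireg _ (by decide), ha.not_done]
  have eM₄ : s₄.rreg yM = s₂.rreg yM :=
    (hF₄.rreg _ (by decide)).trans (hF₃.rreg _ (by decide))
  refine (Runs.seq_frame (T₂ := 1100 * (n * n) + 1100 + 100) (T₁ := 1000)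
    (choose_runs hC₄.env (fun a ha => ha.1.trans hi) (eD₄ ▸ h₄) hd₄) fun s₅ hF₅ h₅ => ?_).mono
    (by omega) fun _ h => h
  have hC₅ := hC₄.of_frame hF₅ (by decide) (by decide) (by decide)
  refine (Runs.seq_frame (T₁ := 1100 * (n * n) + 1100) (T₂ := 100)
    (shift_runs hC₅.env hi (hC₅.xp_eq.trans hsp)) fun s₆ hF₆ h₆ => ?_).mono (by omega)
    fun _ h => h
  have eD₅ : s₅.rarr bD = s₃.rarr bD := (hF₅.rarr _ (by decide)).trans eD₄
  rw [hC₅.bU_eq, hC₅.aT_eq, eD₅] at h₆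
  rw [eD₄, eM₄] at h₅
  obtain ⟨hδD, hδμ, hcase⟩ := h₅
  -- `δ` is the slack of an edge, hence nonnegative
  have hδ0 : 0 ≤ s₅.rreg yD := by
    have key : ∀ a < i, s.iarr aT a ≠ i + 1 → 0 ≤ s₃.rarr bD a := fun a ha hua => by
      obtain ⟨-, h⟩ := hsc.D_eq hne a ha hua
      rw [h]
      have := hs.dual.feas (s₃.iarr aW a) _ (hM.lt a ha)
      linarith
    rcases hcase with ⟨-, -, hmem, hyD⟩ | ⟨-, hyD⟩
    · rw [hyD]
      exact key _ hmem.1 hmem.2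
    · obtain ⟨-, hf, hff, hμ⟩ := hsc.μ_eq hne
      have := hs.dual.feas (s₂.ireg xg) _ hf
      rw [hs.dual.zero _ hf hff] at this
      rw [hyD, hμ]
      linarith
  obtain ⟨v', hd', ht', hsc'⟩ := hsc.shift (δ := s₅.rreg yD) hM hs.dual htr hδ0
    (fun a ha hua => hδD a ⟨ha, hua⟩) hδμ (u' := s₆.rarr bU) (D' := s₆.rarr bD)
    (fun a hua => by simp [h₆.1, hua, Nat.lt_succ_of_le (hs.tree.le a hua)])
    (fun a hua => by simp [h₆.1, hua])
    (fun a ha hua => by simp [h₆.2, hua, Nat.lt_succ_of_lt ha])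
  have e₆aM : s₆.iarr aM = s.iarr aM := (hF₆.iarr _ (by decide)).trans hC₅.aM_eq
  have e₆aF : s₆.iarr aF = s.iarr aF := (hF₆.iarr _ (by decide)).trans hC₅.aF_eq
  have e₆aT : s₆.iarr aT = s.iarr aT := (hF₆.iarr _ (by decide)).trans hC₅.aT_eq
  have e₆aW : s₆.iarr aW = s₃.iarr aW :=
    ((hF₆.iarr _ (by decide)).trans (hF₅.iarr _ (by decide))).trans (hF₄.iarr _ (by decide))
  have e₆xp : s₆.ireg xp = i + 1 := (hF₆.ireg _ (by decide)).trans (hC₅.xp_eq.trans hsp)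
  have e₆xf : s₆.ireg xf = s₂.ireg xf := by
    rw [hF₆.ireg _ (by decide), hF₅.ireg _ (by decide), hF₄.ireg _ (by decide),
      hF₃.ireg _ (by decide)]
  have e₆xg : s₆.ireg xg = s₂.ireg xg := by
    rw [hF₆.ireg _ (by decide), hF₅.ireg _ (by decide), hF₄.ireg _ (by decide),
      hF₃.ireg _ (by decide)]
  have e₆yM : s₆.rreg yM = s₂.rreg yM := by
    rw [hF₆.rreg _ (by decide), hF₅.rreg _ (by decide), eM₄]
  have e₆yD : s₆.rreg yD = s₅.rreg yD := hF₆.rreg _ (by decide)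
  have e₆xs : s₆.ireg xs = s₄.ireg xs := by
    rw [hF₆.ireg _ (by decide), hF₅.ireg _ (by decide)]
  have e₆xd : s₆.ireg xd = s₅.ireg xd := hF₆.ireg _ (by decide)
  rw [← e₆aM, ← e₆aF, ← e₆aT, ← e₆aW, ← e₆yM, ← e₆yD, ← e₆xf, ← e₆xg] at hsc'
  rw [← e₆aM, ← e₆aF] at hd'
  rw [← e₆aM, ← e₆aT, ← e₆aW] at ht'
  have hstamp : ∀ a, s₆.iarr aT a ≤ i + 1 := e₆aT ▸ hs.stamp
  have hne' : {b | s₆.iarr aT b = i + 1}.Nonempty := ⟨i, ht'.root⟩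
  refine Runs.of_wp (by decide) ?_
  simp only [grow, wp, RExp.Ok, RExp.eval, IExp.Ok, IExp.eval, Test.Ok, Test.Holds, true_and,
    zero_le]
  -- after the shift, the edge that attains the least slack is tight
  rcases hcase with ⟨hd, hs0, hmem, hyD⟩ | ⟨hd, hyD⟩
  · rw [← e₆aT, ← e₆xs] at hmem
    have hzero : s₆.rarr bD (s₆.ireg xs - 1) = 0 := by
      have h₁ := hmem.1
      have h₂ := hmem.2
      rw [e₆xs] at h₁ h₂ ⊢
      rw [e₆aT] at h₂
      simp only [h₆.2, h₂, ne_eq, not_false_eq_true, and_true]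
      rw [if_pos (by omega), hyD, sub_self]
    obtain ⟨ht'', hsc''⟩ := ht'.insert hsc' hmem.1 hmem.2 hzero (k := k + 1)
      (fun a ha' => Nat.lt_succ_of_le (ha.rank a (e₆aT ▸ ha')))
    have hr := hmem.1
    have hur := hmem.2
    have hcard : ((Finset.range (i + 1)).filter fun a =>
        Function.update (s₆.iarr aT) (s₆.ireg xs - 1) (i + 1) a = i + 1).card = k + 2 := by
      rw [show k + 2 = k + 1 + 1 from rfl, ← ha.card, ← e₆aT, ← Finset.card_insert_of_notMem
        (s := (Finset.range (i + 1)).filter fun a => s₆.iarr aT a = i + 1)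
        (a := s₆.ireg xs - 1) (by simp [hur])]
      congr 1
      ext a
      by_cases h : a = s₆.ireg xs - 1
      · subst h; simp; omega
      · simp [h]
    -- the rows of the tree are at most `i`, which bounds the number of iterations
    have hki : k + 2 ≤ i + 1 := by
      rw [← hcard]
      exact (Finset.card_filter_le _ _).trans (by simp)
    have hρ : ∀ a, Function.update (s₆.iarr aT) (s₆.ireg xs - 1) (i + 1) a = i + 1 →
        Function.update ρ (s₆.ireg xs - 1) (k + 1) a ≤ k + 1 := by
      intro a h
      by_cases h' : a = s₆.ireg xs - 1
      · simp [h']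
      · rw [Function.update_of_ne h'] at h ⊢
        exact (ha.rank a (e₆aT ▸ h)).trans (Nat.le_succ k)
    simp [e₆xd, hd, e₆xp]
    refine ⟨by omega, by omega, v', Function.update ρ (s₆.ireg xs - 1) (k + 1),
      ⟨by simpa using hd', by simpa using ht'', fun a => ?_, fun a h => ?_⟩, .inl ⟨?_, ?_, ?_, ?_, ?_, ?_⟩⟩
    · by_cases h : a = s₆.ireg xs - 1
      · simp [h]
      · simpa [h] using hstamp a
    · have := hρ a (by simpa using h)
      omega
    · simp [e₆xd, hd]
    · simp
    · intro h; simp at h; omega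
    · intro a h
      exact hρ a (by simpa using h)
    · simpa using hcard
    · simpa using hsc''
  · obtain ⟨h₁, h₂, h₃, h₄⟩ := hsc'.μ_eq hne'
    simp [e₆xd, hd]
    refine ⟨v', ρ, ⟨by simpa using hd', by simpa using ht', by simpa using hstamp,
      fun a h => hs.rank a (e₆aT ▸ h)⟩, .inr ⟨?_, h₁, h₂, h₃, ?_⟩⟩
    · simp [e₆xd, hd]
    · change I.cost (s₆.ireg xg) (s₆.ireg xf) - s₆.rarr bU (s₆.ireg xg) = 0
      rw [← h₄, e₆yM, e₆yD, hyD, sub_self]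

/-- The search for an augmenting path. -/
def search : Prog := .loop (.ieq (.reg xd) (.const 0)) searchStep

theorem search_runs {S W : ℕ} {s : State} (hE : I.Env S W s) {i : ℕ} (hi : i < n * n)
    (hsi : s.ireg xi = i) (hsp : s.ireg xp = i + 1) (hM : I.Matching i (s.iarr aM) (s.iarr aF))
    (hT : I.IsTable (s.iarr aF) (s.iarr aB)) (hs : I.SearchInv i 0 s) :
    Runs S W search s (n * n * (1100 * I.numBlocks + 3300 * (n * n) + 10010) + 10) fun s' =>
      ∃ v ρ, I.TreeState i v ρ s' ∧ I.Finished i s' := by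
  refine (Runs.loop (T := 1100 * I.numBlocks + 3300 * (n * n) + 10000) (n * n)
    (fun k s' => I.SearchInv i k s') hs
    (fun k s' _ _ => by simp [Test.Ok, IExp.Ok]) ?_).mono ?_ ?_
  · rintro k s₁ hF ⟨v, ρ, hts, ha | hf⟩ hb
    · have e₁ : s₁.iarr aM = s.iarr aM := hF.iarr _ (by decide)
      have e₂ : s₁.iarr aF = s.iarr aF := hF.iarr _ (by decide)
      have e₃ : s₁.iarr aB = s.iarr aB := hF.iarr _ (by decide)
      refine ⟨?_, searchStep_runs (hE.of_frame hF (by decide) (by decide)) hi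
        ((hF.ireg _ (by decide)).trans hsi) ((hF.ireg _ (by decide)).trans hsp)
        (by rwa [e₁, e₂]) (by rwa [e₂, e₃]) hts ha⟩
      have := Finset.card_filter_le (Finset.range (i + 1)) (fun a => s₁.iarr aT a = i + 1)
      rw [ha.card, Finset.card_range] at this
      omega
    · have h₁ : s₁.ireg xd = 0 := hb
      have h₂ := hf.done
      omega
  · have : (Test.ieq (.reg xd) (.const 0)).cost = 3 := rfl
    rw [this]
    exact le_of_eq_of_le (by ring) (Nat.add_le_add (Nat.mul_le_mul_left (n * n) (show
      1100 * I.numBlocks + 3300 * (n * n) + 10004 ≤ 1100 * I.numBlocks + 3300 * (n * n) + 10010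
      by omega)) (show 4 ≤ 10 by omega))
  · rintro s' ⟨⟨k, v, ρ, hts, ha | hf⟩, hb⟩
    · exact absurd ha.not_done hb
    · exact ⟨v, ρ, hts, hf⟩

/-! ### The phases -/

/-- One step of the change of the matching along the path to the root. -/
def augmentStep : Prog :=
  .seq (.iset xj (.get aM (.reg xr))) (.seq (.iput aM (.reg xr) (.get aM (.reg xi)))
    (.seq (.iput aM (.reg xi) (.reg xj)) (.iset xr (.get aW (.reg xr)))))

/-- Changes the matching along the path from the row `xr` to the root `xi`. -/
def augment : Prog := .loop (.not (.ieq (.reg xr) (.reg xi))) augmentStep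

theorem augment_runs {S W : ℕ} {s : State} (hE : I.Env S W s) {i : ℕ} (hi : i < n * n)
    (hsi : s.ireg xi = i) {M₀ free : ℕ → ℕ} {v : ℕ → ℝ} {ρ : ℕ → ℕ}
    (ht : I.Tree i M₀ (s.iarr aT) (s.iarr aW) ρ (s.rarr bU) v)
    (hρ : ∀ a, s.iarr aT a = i + 1 → ρ a ≤ i)
    (ha : I.Augmenting i M₀ (s.iarr aM) free (s.iarr aT) ρ (s.rarr bU) v (s.ireg xr)) :
    Runs S W augment s (n * n * 30 + 10) fun s' =>
      I.Augmenting i M₀ (s'.iarr aM) free (s.iarr aT) ρ (s.rarr bU) v i := by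
  have hS := hE.S_ge
  have hlt := hE.lt
  -- the time `ρ` at which the current row was added to the tree decreases
  refine (Runs.loop (T := 25) (n * n) (fun k s' => s'.ireg xi = i ∧ ρ (s'.ireg xr) + k ≤ i ∧
    I.Augmenting i M₀ (s'.iarr aM) free (s.iarr aT) ρ (s.rarr bU) v (s'.ireg xr))
    ⟨hsi, hρ _ ha.mem, ha⟩ (fun k s' _ _ => by simp [Test.Ok, IExp.Ok]) ?_).mono ?_ ?_
  · rintro k s₁ hF ⟨hsi₁, hk, ha₁⟩ hb
    have eW : s₁.iarr aW = s.iarr aW := hF.iarr _ (by decide)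
    have hri : s₁.ireg xr ≠ i := by simpa [Test.Holds, IExp.eval, hsi₁] using hb
    have hrle := ht.le _ ha₁.mem
    obtain ⟨hlt', hstep⟩ := ha₁.step ht hri
    refine ⟨by omega, Runs.of_wp (by decide) ?_⟩
    simp [augmentStep, wp, IExp.Ok, IExp.eval, hsi₁, eW]
    exact ⟨by omega, by omega, by omega, by omega, by omega, hstep⟩
  · have : (Test.not (.ieq (.reg xr) (.reg xi))).cost = 4 := rfl
    rw [this]
    omega
  · rintro s' ⟨⟨k, hsi', -, ha'⟩, hb⟩
    have h : s'.ireg xr = s'.ireg xi := not_not.1 hb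
    rwa [h, hsi'] at ha'

/-- Recomputes the entries of the table in the column block `xc`. -/
def updateTable : Prog :=
  forLoop xh xK (.seq (.iset xt (.add (.mul (.reg xh) (.reg xB)) (.reg xc))) blockMin)

theorem updateTable_runs {S W : ℕ} {s : State} (hE : I.Env S W s) {free : ℕ → ℕ} {f : ℕ}
    (hn : 0 < n) (hf : f < m + l) (hfree : s.iarr aF = Function.update free f 0)
    (hsc : s.ireg xc = f / (n * n)) (hT : I.IsTable free (s.iarr aB)) :
    Runs S W updateTable s (n * n * (1100 * (n * n) + 1120) + 6) fun s' =>
      I.IsTable (s.iarr aF) (s'.iarr aB) := by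
  have hle := numBlocks_mul_le (I := I) hE.lt
  have hW := hE.W_ge
  have hlt := hE.lt
  have hnb : 0 < I.numBlocks := Nat.succ_pos _
  set b := f / (n * n) with hb
  have hblt : b < I.numBlocks := Nat.lt_succ_of_le (Nat.div_le_div_right hf.le)
  refine (Runs.forLoop (T := 1100 * (n * n) + 1110) (B := n * n) (fun k s' =>
    ∀ t < n * n * I.numBlocks, (t % I.numBlocks ≠ b ∨ t / I.numBlocks < k) →
      IsArgmin (I.cost (t / I.numBlocks)) (I.freeIn (s.iarr aF) (t % I.numBlocks)) (s'.iarr aB t))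
    hE.xK_eq (by omega) (by decide) (by decide) (by decide) ?_ ?_).mono
    (Nat.add_le_add_right (Nat.mul_le_mul_left _ (by omega)) _) ?_
  · -- outside the block of `f`, the table is still correct
    intro t ht h
    have hne := h.resolve_right (Nat.not_lt_zero _)
    convert hT t ht using 1
    ext j
    simp only [freeIn, Set.mem_ofPred_eq, hfree]
    by_cases hj : j = f
    · subst hj
      simp [Ne.symm hne, ← hb]
    · simp [hj]
  · intro k s₁ hk hF hsk h
    have hE₁ := hE.of_frame hF (by decide) (by decide)
    have htlt : k * I.numBlocks + b < n * n * I.numBlocks :=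
      lt_of_lt_of_le (by rw [Nat.succ_mul]; omega) (Nat.mul_le_mul_right _ hk)
    have hd : (k * I.numBlocks + b) / I.numBlocks = k := by
      rw [mul_comm, Nat.mul_add_div hnb, Nat.div_eq_of_lt hblt, add_zero]
    have hm : (k * I.numBlocks + b) % I.numBlocks = b := by
      rw [mul_comm, Nat.mul_add_mod, Nat.mod_eq_of_lt hblt]
    have hsc₁ : s₁.ireg xc = b := (hF.ireg _ (by decide)).trans hsc
    refine (Runs.seq_frame (T₁ := 10) (T₂ := 1100 * (n * n) + 1100)
      (R := fun s' => s'.ireg xt = k * I.numBlocks + b)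
      (Runs.of_wp (by decide) ?_) fun s₂ hF₂ h₂ => ?_).mono (by omega) fun _ h => h
    · simp [wp, IExp.Ok, IExp.eval, hsk, hsc₁, hE₁.xB_eq hn]
      omega
    · refine (blockMin_runs (hE₁.of_frame hF₂ (by decide) (by decide)) htlt h₂).mono le_rfl ?_
      rintro s₃ ⟨e, h₃, h₄⟩ t ht htk
      have eF : s₂.iarr aF = s.iarr aF :=
        (hF₂.iarr _ (by decide)).trans (hF.iarr _ (by decide))
      have eB : s₂.iarr aB = s₁.iarr aB := hF₂.iarr _ (by decide)
      rw [eF] at h₄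
      simp only [h₃, eB]
      by_cases htt : t = k * I.numBlocks + b
      · subst htt
        simpa using h₄
      · rw [Function.update_of_ne htt]
        refine h t ht ?_
        by_contra! hcon
        have h₅ : t / I.numBlocks = k := by
          have := htk.resolve_left (not_not.2 hcon.1)
          omega
        have := Nat.div_add_mod t I.numBlocks
        rw [h₅, hcon.1, mul_comm] at this
        exact htt this.symm
  · intro s' h t ht
    exact h t ht (.inr (Nat.div_lt_of_lt_mul (by rwa [mul_comm])))

/-- The rows below `i` have been matched optimally. -/
structure PhaseInv (I : Data n m l) (i : ℕ) (s : State) : Prop where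
  matching : I.Matching i (s.iarr aM) (s.iarr aF)
  table : I.IsTable (s.iarr aF) (s.iarr aB)
  dual : ∃ v, I.Dual i (s.iarr aM) (s.iarr aF) (s.rarr bU) v
  stamp : ∀ a, s.iarr aT a ≤ i

/-- Makes the row `xi` the root of a new tree. -/
def startSearch : Prog :=
  .seq (.iset xp (.add (.reg xi) (.const 1))) (.seq (.iset xr (.reg xi))
    (.seq (.iput aT (.reg xi) (.reg xp)) (.iset xd (.const 0))))

/-- Takes the free column `xf` for the row `xg`, via the cell of the row `xi`. -/
def startAugment : Prog :=
  .seq (.iset xc (.div (.reg xf) (.reg xK))) (.seq (.iput aF (.reg xf) (.const 0))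
    (.seq (.iput aM (.reg xi) (.reg xf)) (.iset xr (.reg xg))))

/-- One phase of the Hungarian method: the row `xi` is matched. -/
def phase : Prog :=
  .seq startSearch (.seq search (.seq startAugment (.seq augment updateTable)))

theorem startSearch_runs {S W : ℕ} {s : State} (hE : I.Env S W s) {i : ℕ} (hi : i < n * n)
    (hsi : s.ireg xi = i) (h : I.PhaseInv i s) :
    Runs S W startSearch s 30 fun s' => s'.ireg xp = i + 1 ∧ I.SearchInv i 0 s' := by
  have hS := hE.S_ge
  have hW := hE.W_ge
  have hlt := hE.lt
  obtain ⟨v, hd⟩ := h.dual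
  have hT : ∀ a, Function.update (s.iarr aT) i (i + 1) a = i + 1 ↔ a = i := fun a => by
    by_cases ha : a = i
    · simp [ha]
    · have := h.stamp a
      simp [ha]
      omega
  refine Runs.of_wp (by decide) ?_
  simp [startSearch, wp, IExp.Ok, IExp.eval, hsi]
  refine ⟨by omega, by omega, v, fun _ => 0, ⟨by simpa using hd, ?_, fun a => ?_, by simp⟩,
    .inl ⟨by simp, ?_, ?_, by simp, ?_, ?_⟩⟩
  · refine ⟨fun a ha => ?_, ?_, fun a ha hai => ?_⟩
    · simp [hT] at ha
      exact ha.le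
    · simp
    · simp [hT] at ha
      exact absurd ha hai
  · by_cases ha : a = i
    · simp [ha]
    · have := h.stamp a
      simp [ha]
      omega
  · simp
  · intro _ b hb
    simpa [hT] using hb
  · simp [hT]
  · have hR : {b | Function.update (s.iarr aT) i (i + 1) b = i + 1 ∧ b ≠ i} = ∅ := by
      ext b
      simp [hT]
    simp only [ne_eq] at hR
    simp [hR]
    exact ⟨by simp, by simp, by simp, by simp⟩

theorem phase_runs {S W : ℕ} {s : State} (hE : I.Env S W s) {i : ℕ} (hi : i < n * n)
    (hsi : s.ireg xi = i) (h : I.PhaseInv i s) :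
    Runs S W phase s (n * n * (1100 * I.numBlocks + 4400 * (n * n) + 12000) + 100)
      (I.PhaseInv (i + 1)) := by
  have hS := hE.S_ge
  have hW := hE.W_ge
  have hlt := hE.lt
  have hn : 0 < n := by
    rcases Nat.eq_zero_or_pos n with rfl | h
    · simp at hi
    · exact h
  refine (Runs.seq_frame (T₂ := (n * n * (1100 * I.numBlocks + 3300 * (n * n) + 10010) + 10) +
    (30 + ((n * n * 30 + 10) + (n * n * (1100 * (n * n) + 1120) + 6))))
    (startSearch_runs hE hi hsi h) fun s₁ hF₁ h₁ => ?_).mono ?_ fun _ h => h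
  swap
  · have h₁ : n * n * (1100 * I.numBlocks + 4400 * (n * n) + 12000) =
      n * n * (1100 * I.numBlocks + 3300 * (n * n) + 10010) + n * n * 30 +
        n * n * (1100 * (n * n) + 1120) + n * n * 840 := by ring
    omega
  obtain ⟨hsp, hinv⟩ := h₁
  have hE₁ := hE.of_frame hF₁ (by decide) (by decide)
  have hsi₁ : s₁.ireg xi = i := (hF₁.ireg _ (by decide)).trans hsi
  have eM₁ : s₁.iarr aM = s.iarr aM := hF₁.iarr _ (by decide)
  have eF₁ : s₁.iarr aF = s.iarr aF := hF₁.iarr _ (by decide)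
  have eB₁ : s₁.iarr aB = s.iarr aB := hF₁.iarr _ (by decide)
  refine Runs.seq_frame (search_runs hE₁ hi hsi₁ hsp (eM₁ ▸ eF₁ ▸ h.matching)
    (eF₁ ▸ eB₁ ▸ h.table) hinv) fun s₂ hF₂ h₂ => ?_
  obtain ⟨v, ρ, hts, hfin⟩ := h₂
  have hE₂ := hE₁.of_frame hF₂ (by decide) (by decide)
  have hsi₂ : s₂.ireg xi = i := (hF₂.ireg _ (by decide)).trans hsi₁
  have eM₂ : s₂.iarr aM = s.iarr aM := (hF₂.iarr _ (by decide)).trans eM₁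
  have eF₂ : s₂.iarr aF = s.iarr aF := (hF₂.iarr _ (by decide)).trans eF₁
  have eB₂ : s₂.iarr aB = s.iarr aB := (hF₂.iarr _ (by decide)).trans eB₁
  have hf := hfin.lt
  refine Runs.seq_frame (T₁ := 30) (R := fun s' => s'.ireg xc = s₂.ireg xf / (n * n) ∧
    s'.iarr aF = Function.update (s₂.iarr aF) (s₂.ireg xf) 0 ∧
    s'.iarr aM = Function.update (s₂.iarr aM) i (s₂.ireg xf) ∧ s'.ireg xr = s₂.ireg xg)
    (Runs.of_wp (by decide) ?_) fun s₃ hF₃ h₃ => ?_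
  · simp [startAugment, wp, IExp.Ok, IExp.eval, hsi₂, hE₂.xK_eq, hn.ne']
    omega
  obtain ⟨hc₃, eF₃, eM₃, er₃⟩ := h₃
  have hE₃ := hE₂.of_frame hF₃ (by decide) (by decide)
  have hsi₃ : s₃.ireg xi = i := (hF₃.ireg _ (by decide)).trans hsi₂
  have eT₃ : s₃.iarr aT = s₂.iarr aT := hF₃.iarr _ (by decide)
  have eW₃ : s₃.iarr aW = s₂.iarr aW := hF₃.iarr _ (by decide)
  have eU₃ : s₃.rarr bU = s₂.rarr bU := hF₃.rarr _ (by decide)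
  have hM₂ : I.Matching i (s₂.iarr aM) (s₂.iarr aF) := eM₂ ▸ eF₂ ▸ h.matching
  refine Runs.seq_frame (augment_runs hE₃ hi hsi₃ (M₀ := s₂.iarr aM) (ρ := ρ) (v := v)
    (free := s₃.iarr aF)
    (by rw [eT₃, eW₃, eU₃]; exact hts.tree) (by rw [eT₃]; exact hts.rank) ?_) fun s₄ hF₄ h₄ => ?_
  · rw [eM₃, eF₃, eT₃, eU₃, er₃]
    exact Augmenting.start hM₂ hts.dual hfin.mem hf hfin.free hfin.tight
  have hE₄ := hE₃.of_frame hF₄ (by decide) (by decide)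
  have eF₄ : s₄.iarr aF = s₃.iarr aF := hF₄.iarr _ (by decide)
  refine (updateTable_runs hE₄ hn hf (free := s₂.iarr aF) (eF₄.trans eF₃)
    ((hF₄.ireg _ (by decide)).trans hc₃) ?_).frame.mono le_rfl ?_
  · have eB₄ : s₄.iarr aB = s.iarr aB :=
      (hF₄.iarr _ (by decide)).trans ((hF₃.iarr _ (by decide)).trans eB₂)
    rw [eB₄, eF₂]
    exact h.table
  · rintro s₅ ⟨h₅, hF₅⟩
    have eM₅ : s₅.iarr aM = s₄.iarr aM := hF₅.iarr _ (by decide)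
    have eF₅ : s₅.iarr aF = s₃.iarr aF := (hF₅.iarr _ (by decide)).trans eF₄
    have eU₅ : s₅.rarr bU = s₃.rarr bU := (hF₅.rarr _ (by decide)).trans (hF₄.rarr _ (by decide))
    have eT₅ : s₅.iarr aT = s₂.iarr aT :=
      ((hF₅.iarr _ (by decide)).trans (hF₄.iarr _ (by decide))).trans eT₃
    refine ⟨?_, ?_, ⟨v, ?_⟩, ?_⟩
    · rw [eM₅, eF₅]; exact h₄.matching
    · rw [eF₅, ← eF₄]; exact h₅
    · rw [eM₅, eF₅, eF₃, eU₅, eU₃]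
      rw [eF₃, eU₃] at h₄
      exact Augmenting.finish hts.dual h₄
    · rw [eT₅]; exact hts.stamp

/-- Computes the fixed parameters. The divisor is `max 1 (n * n)`, so that it is positive also for
`n = 0`. -/
def setup : Prog :=
  .seq (.iset xN (.add (.reg xm) (.reg xl))) (.seq (.iset xK (.mul (.reg xn) (.reg xn)))
    (.seq (.iset xB (.add (.div (.reg xN) (.add (.reg xK) (.sub (.const 1) (.reg xK)))) (.const 1)))
      (.iset xQ (.mul (.reg xK) (.reg xB)))))

/-- The algorithm. It leaves the mark `1` at the pairs that are not matched to an ordered pair of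
inner points. -/
def hungarian : Prog :=
  .seq setup (.seq (forLoop xj xN (.iput aF (.reg xj) (.const 1)))
    (.seq (forLoop xt xQ blockMin) (forLoop xi xK phase)))

theorem setup_runs {S W : ℕ} (hlt : n * n < m + l) (hS : 4 * (m + l) ≤ S) (hW : 4 * (m + l) ≤ W) :
    Runs S W setup I.input 40 (I.Env S W) := by
  have hle := numBlocks_mul_le (I := I) hlt
  have hQ : n * n * ((m + l) / (n * n + (1 - n * n)) + 1) = n * n * I.numBlocks := by
    rcases Nat.eq_zero_or_pos n with rfl | h
    · simp
    · have : 0 < n * n := by positivity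
      rw [show n * n + (1 - n * n) = n * n by omega, numBlocks]
  have hdiv : (m + l) / (n * n + (1 - n * n)) ≤ m + l := Nat.div_le_self _ _
  refine Runs.of_wp (by decide) ?_
  have e0 : I.input.ireg 0 = n := rfl
  have e1 : I.input.ireg 1 = m := rfl
  have e2 : I.input.ireg 2 = l := rfl
  simp only [setup, wp, IExp.Ok, IExp.eval, Function.update_apply, e0, e1, e2]
  simp only [Nat.reduceEqDiff, if_true, if_false, true_and, OfNat.zero_ne_ofNat, hQ]
  refine ⟨by omega, by omega, ⟨⟨⟨⟨by omega, trivial⟩, by omega⟩, by omega⟩, by omega, by omega⟩, by omega,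
    hlt, hS, hW, rfl, by simp, by simp, fun hn => ?_, by simp, rfl, rfl, rfl, rfl, rfl, rfl⟩
  have : 0 < n * n := by positivity
  simp [numBlocks, show n * n + (1 - n * n) = n * n by omega]

theorem hungarian_runs {S W : ℕ} (hlt : n * n < m + l) (hS : 4 * (m + l) ≤ S) (hW : 4 * (m + l) ≤ W) :
    Runs S W hungarian I.input (40 + ((m + l) * 18 + 6) +
      (n * n * I.numBlocks * (1100 * (n * n) + 1108) + 6) +
      (n * n * (n * n * (1100 * I.numBlocks + 4400 * (n * n) + 12000) + 108) + 6))
      (I.PhaseInv (n * n)) := by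
  have hle := numBlocks_mul_le (I := I) hlt
  refine (Runs.seq_frame (setup_runs hlt hS hW) fun s₁ hF₁ hE₁ =>
    Runs.seq_frame (Runs.forLoop (T := 10) (fun k s' => ∀ j < k, s'.iarr aF j = 1) hE₁.xN_eq
      (by omega) (by decide) (by decide) (by decide) (by simp) ?_) fun s₂ hF₂ h₂ =>
    Runs.seq_frame (Runs.forLoop (T := 1100 * (n * n) + 1100) (fun k s' => ∀ t < k,
      IsArgmin (I.cost (t / I.numBlocks)) (I.freeIn (s₂.iarr aF) (t % I.numBlocks)) (s'.iarr aB t))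
      (hE₁.of_frame hF₂ (by decide) (by decide)).xQ_eq
      (by omega) (by decide) (by decide) (by decide) (by simp) ?_) fun s₃ hF₃ h₃ =>
    Runs.forLoop (T := n * n * (1100 * I.numBlocks + 4400 * (n * n) + 12000) + 100)
      (fun i s' => I.PhaseInv i s')
      ((hE₁.of_frame hF₂ (by decide) (by decide)).of_frame hF₃ (by decide) (by decide)).xK_eq
      (by omega) (by decide) (by decide) (by decide) ?_ ?_).mono ?_ fun _ h => h
  · intro k s' hk hF hsk h
    refine Runs.of_wp (by decide) ?_
    simp [wp, IExp.Ok, IExp.eval, hsk]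
    refine ⟨⟨by omega, by omega⟩, fun j hj => ?_⟩
    by_cases hjk : j = k
    · simp [hjk]
    · simp [hjk, h j (by omega)]
  · intro k s' hk hF hsk h
    have hE' := (hE₁.of_frame hF₂ (by decide) (by decide)).of_frame hF (by decide) (by decide)
    refine (blockMin_runs hE' hk hsk).mono le_rfl ?_
    rintro s'' ⟨e, h', h''⟩ t ht
    have eF : s'.iarr aF = s₂.iarr aF := hF.iarr _ (by decide)
    rw [eF] at h''
    simp only [h']
    by_cases htk : t = k
    · subst htk; simpa using h''
    · rw [Function.update_of_ne htk]; exact h t (by omega)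
  · have eF : s₃.iarr aF = s₂.iarr aF := hF₃.iarr _ (by decide)
    have eU : s₃.rarr bU = fun _ => 0 := by
      rw [hF₃.rarr _ (by decide), hF₂.rarr _ (by decide), hF₁.rarr _ (by decide)]; rfl
    have eT : s₃.iarr aT = fun _ => 0 := by
      rw [hF₃.iarr _ (by decide), hF₂.iarr _ (by decide), hF₁.iarr _ (by decide)]; rfl
    refine ⟨⟨by simp, by simp, fun j hj => ?_⟩, ?_, ⟨fun _ => 0, fun a j hj => ?_, by simp, by simp,
      by simp⟩, by simp [eT]⟩
    · simp [eF, h₂ j hj]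
    · intro t ht
      simpa [eF] using h₃ t ht
    · simpa [eU] using I.cost_nonneg a j
  · intro i s' hi hF hsi h
    have hE' := ((hE₁.of_frame hF₂ (by decide) (by decide)).of_frame hF₃ (by decide)
      (by decide)).of_frame hF (by decide) (by decide)
    refine (phase_runs hE' hi hsi h).mono le_rfl fun s'' h'' => ?_
    exact ⟨by simpa using h''.matching, by simpa using h''.table, by simpa using h''.dual,
      by simpa using h''.stamp⟩
  · simp only [Nat.add_assoc, Nat.reduceAdd]
    exact le_rfl

theorem hungarian_time_le (hlt : n * n < m + l) :
    40 + ((m + l) * 18 + 6) + (n * n * I.numBlocks * (1100 * (n * n) + 1108) + 6) +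
      (n * n * (n * n * (1100 * I.numBlocks + 4400 * (n * n) + 12000) + 108) + 6) ≤
    100000 * ((m + l) * (max 1 n) ^ 2 + n ^ 6) := by
  have hle := numBlocks_mul_le (I := I) hlt
  set N := m + l
  set K := n * n with hK
  set B := I.numBlocks
  have h1 : 1 ≤ (max 1 n) ^ 2 := Nat.one_le_pow _ _ (by simp)
  have h2 : K ≤ (max 1 n) ^ 2 := by
    rw [hK, ← pow_two]; exact Nat.pow_le_pow_left (by simp) 2
  set X := (max 1 n) ^ 2
  have h3 : n ^ 6 = K * K * K := by rw [hK]; ring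
  rw [h3]
  have h4 : K * B * K ≤ 2 * N * X := Nat.mul_le_mul hle h2
  have h5 : N ≤ N * X := Nat.le_mul_of_pos_right _ h1
  have h6 : K * K ≤ N * X := Nat.mul_le_mul hlt.le h2
  nlinarith

end Programs

/-! ### From the matching to an optimal solution -/

/-- The pairs that are marked in the final state are redundant in some optimal solution, and all but
`n * n` pairs are marked. -/
theorem PhaseInv.exists_isOptimal {s : RealRAM.State} (hlt : n * n < m + l) (h : I.PhaseInv (n * n) s) :
    (Finset.univ.filter fun j : Fin (m + l) => s.iarr 0 j = 1).card = m + l - n * n ∧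
    ∃ σ, I.IsOptimal σ ∧ ∀ j : Fin (m + l), s.iarr 0 j = 1 → σ j = [] := by
  obtain ⟨v, hd⟩ := h.dual
  have hidx : ∀ a : Fin n × Fin n, (a.1 * n + a.2 : ℕ) < n * n := fun a =>
    lt_of_lt_of_le (Nat.add_lt_add_left a.2.2 _)
      (by rw [← Nat.succ_mul]; exact Nat.mul_le_mul_right _ a.1.2)
  let M : Fin n × Fin n → Fin (m + l) := fun a =>
    ⟨s.iarr 1 (a.1 * n + a.2), h.matching.lt _ (hidx a)⟩
  have hM : Function.Injective M := by
    intro a b hab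
    have hab := h.matching.inj _ (hidx a) _ (hidx b) (Fin.mk.inj hab)
    have hn : 0 < n := a.1.pos
    have key : ∀ c : Fin n × Fin n, (c.1 * n + c.2 : ℕ) / n = c.1 ∧ (c.1 * n + c.2 : ℕ) % n = c.2 :=
      fun c => by
        rw [mul_comm, Nat.mul_add_div hn, Nat.mul_add_mod, Nat.div_eq_of_lt c.2.2,
          Nat.mod_eq_of_lt c.2.2]
        simp
    refine Prod.ext (Fin.ext ?_) (Fin.ext ?_)
    · rw [← (key a).1, hab, (key b).1]
    · rw [← (key a).2, hab, (key b).2]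
  have hfree : ∀ j : Fin (m + l), s.iarr 0 j = 1 ↔ j ∉ Set.range M := by
    intro j
    rw [h.matching.free_iff j j.2]
    constructor
    · rintro h' ⟨a, rfl⟩
      exact h' _ (hidx a) rfl
    · intro h' a ha haj
      have hn : 0 < n := Nat.pos_of_ne_zero (by rintro rfl; simp at ha)
      refine h' ⟨(⟨a / n, Nat.div_lt_of_lt_mul ha⟩, ⟨a % n, Nat.mod_lt _ hn⟩), Fin.ext ?_⟩
      simpa [M, Nat.div_add_mod'] using haj
  constructor
  · have : (Finset.univ.filter fun j : Fin (m + l) => s.iarr 0 j = 1)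
        = (Finset.univ.image M)ᶜ := by
      ext j
      simp [hfree j]
    rw [this, Finset.card_compl, Finset.card_image_of_injective _ hM]
    simp
  · obtain ⟨σ, hσ, hσ'⟩ := I.exists_isOptimal_of_dual (by omega) M hM
      (fun a => s.rarr 6 (a.1 * n + a.2)) (fun j => v j)
      (fun a j => by rw [← I.cost_eq_detour]; exact hd.feas _ _ j.2)
      (fun a => by rw [← I.cost_eq_detour]; exact hd.tight _ (hidx a))
      (fun j => hd.nonpos j) (fun j hj => hd.zero j j.2 ((hfree j).2 hj))
    exact ⟨σ, hσ, fun j hj => hσ' j ((hfree j).1 hj)⟩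

end Data

end GETSPH

end

theorem mainTheorem5 :
    ∃ (P : RealRAM.Prog) (C : ℕ),
      ∀ (n m l : ℕ) (I : GETSPH.Data n m l), I.IsInstance → n ^ 2 < m + l →
        ∃ (t : ℕ) (s : RealRAM.State) (T₀ : Finset (Fin m)) (H₀ : Finset (Fin l)),
          RealRAM.Exec (C * (m + l)) (C * (m + l) ^ C) P I.input t s ∧
          t ≤ C * ((m + l) * (max 1 n) ^ 2 + n ^ 6) ∧
          GETSPH.IsOutput s T₀ H₀ ∧
          T₀.card + H₀.card = m + l - n ^ 2 ∧
          ∃ σ : Fin (m + l) → List (Fin n), I.IsOptimal σ ∧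
            (∀ i ∈ T₀, σ (Fin.castAdd l i) = []) ∧
            (∀ i ∈ H₀, σ (Fin.natAdd m i) = []) := by
  refine ⟨GETSPH.Data.hungarian, 100000, fun n m l I _ hlt => ?_⟩
  generalize hC : 100000 = C
  have hlt' : n * n < m + l := by rwa [← pow_two]
  have hS : 4 * (m + l) ≤ C * (m + l) := Nat.mul_le_mul_right _ (by omega)
  have hW : 4 * (m + l) ≤ C * (m + l) ^ C :=
    hS.trans (Nat.mul_le_mul_left _ (Nat.le_self_pow (by omega) _))
  obtain ⟨t, s, hex, ht, hs⟩ := GETSPH.Data.hungarian_runs (I := I) hlt' hS hW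
  obtain ⟨hcard, σ, hσ, hred⟩ := hs.exists_isOptimal hlt'
  refine ⟨t, s, Finset.univ.filter fun i => s.iarr 0 i = 1,
    Finset.univ.filter fun i => s.iarr 0 (m + i) = 1, hex,
    ht.trans (hC ▸ GETSPH.Data.hungarian_time_le hlt'), ⟨by simp, by simp⟩, ?_, σ, hσ, ?_, ?_⟩
  · rw [pow_two, ← hcard]
    simp only [Finset.card_filter, Fin.sum_univ_add, Fin.val_castAdd, Fin.val_natAdd]
  · exact fun i hi => hred _ (by simpa using hi)
  · exact fun i hi => hred _ (by simpa using hi)
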